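/- Let $s>1$, let $\Omega\subset\mathbb C^n$ be open, and let $\Phi\in\mathcal G^s(\Omega;\mathbb R)$ be strictly plurisubharmonic: $\sum_{j,k}\partial_{x_j}\partial_{\bar x_k}\Phi(x)\,\xi_j\bar\xi_k\ge c(x)|\xi|^2$ for $x\in\Omega$, $\xi\in\mathbb C^n$, with $c>0$ continuous. Here $\mathcal G^s(\Omega)$ is the set of smooth functions $u$ with $|\partial^\alpha u|\le A_KC_K^{|\alpha|}\alpha!^s$ on each compact $K\subset\Omega$ for all $\alpha$, and $\mathcal G^s_{\rm b}$ is the class in which one pair of constants works on the whole set. Let $U\Subset\Omega$ be an open neighbourhood of $x_0$, let $\rho>0$, and put $\widetilde U=\{(x+z,\bar x-\bar z): x\in U,\ z\in\mathbb C^n,\ |z|<\rho\}\subset\mathbb C^{2n}$. Let $\Psi\in\mathcal G^s_{\rm b}(\widetilde U)$ satisfy $\Psi(x,\bar x)=\Phi(x)$ for $x\in U$ and, for some $C>0$, $$|\partial_{\bar x,\bar y}\Psi(x,y)|\le C\exp\bigl(-C^{-1}|x-\bar y|^{-\frac1{s-1}}\bigr),\quad (x,y)\in\widetilde U,$$ and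 put $\phi(y,\tilde x;x,\tilde y)=\Psi(x,\tilde y)-\Psi(x,\tilde x)-\Psi(y,\tilde y)+\Psi(y,\tilde x)$. An amplitude is a family $a(\cdot;h)\in C^\infty(\widetilde U)$, $0<h\le h_0$, for which there are $a_j\in C^\infty(\widetilde U)$ and $C>0$ such that, for all $0<h\le h_0$, $\alpha\in\mathbb N^{4n}$, $N\in\mathbb N$, $$\Bigl\|\partial^\alpha\Bigl(a-\sum_{j<N}a_jh^j\Bigr)\Bigr\|_{L^\infty(\widetilde U)}\le C^{1+|\alpha|+N}\alpha!^sN!^{2s-1}h^N,\qquad |\partial_{\bar x,\bar y}a(x,y;h)|\le C\exp\bigl(-C^{-1}|x-\bar y|^{-\frac1{s-1}}\bigr)\ \text{ on }\widetilde U .$$ A good contour over a set $V\subset\mathbb C^n$ with constant $K>0$ is a family $\Gamma(y,\bar y)=\gamma(y,D)$, $y\in\overline V$, where $D$ is a compact neighbourhood of $0$ in $\mathbb R^{2n}$, $\gamma$ is a smooth map from a neighbourhood of $\overline V\times D$ to $\mathbb C^n\times\mathbb C^n$, and for every $y\in\overline V$: $\gamma(y,\cdot)$ is an injective immersion on $D$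 with $\gamma(y,0)=(y,\bar y)$; the points $(x,\tilde y)$, $(x,\bar y)$, $(y,\tilde y)$, $(y,\bar y)$ lie in $\widetilde U$ for all $(x,\tilde y)\in\Gamma(y,\bar y)$; $$\operatorname{Re}\phi(y,\bar y;x,\tilde y)\le-K^{-1}\operatorname{dist}\bigl((x,\tilde y),(y,\bar y)\bigr)^2,\quad (x,\tilde y)\in\Gamma(y,\bar y);$$ and the orientation is that of the affine contour $z\mapsto(y+z,\bar y-\bar z)$, i.e. the map $t\mapsto x-\overline{\tilde y}$, $(x,\tilde y)=\gamma(y,t)$, from $\mathbb R^{2n}$ to $\mathbb C^n\cong\mathbb R^{2n}$, $z\mapsto(\operatorname{Re}z,\operatorname{Im}z)$, has positive Jacobian determinant at $t=0$. Put $$(A_\Gamma a)(y,\bar y;h)=\frac1{(2ih)^n}\int_{\Gamma(y,\bar y)}e^{\frac2h\phi(y,\bar y;x,\tilde y)}a(x,\tilde y;h)\,dx\,d\tilde y .$$ Then there is an open neighbourhood $V_0$ of $x_0$ with $\overline{V_0}$ compact and contained in $U$ such that for every amplitude $a$ and every $K>0$ there is $C>0$, depending only on $a$, $\phi$, $s$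 (and $V_0$) and $K$, with the following property. For every $V\subset V_0$ (in particular $V=V_0$) and any two good contours $\Gamma_0,\Gamma_1$ over $V$ with constant $K$, we have, uniformly for $y\in V$ and $0<h\le h_0$, $$(A_{\Gamma_0}a)(y,\bar y;h)-(A_{\Gamma_1}a)(y,\bar y;h)=\mathcal O(1)\exp\bigl(-C^{-1}h^{-\frac1{2s-1}}\bigr),$$ where the constant in $\mathcal O(1)$ may depend on the contours. -/

import Mathlib

open scoped ContDiff

noncomputable section

namespace GevreyBergman

/-- `ℂⁿ` with the Euclidean norm. -/
abbrev Cn (n : ℕ) : Type := EuclideanSpace ℂ (Fin n)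

/-- `ℝ²ⁿ`; the index `inl j` stands for `Re z_j`, the index `inr j` for `Im z_j`. -/
abbrev R2n (n : ℕ) : Type := EuclideanSpace ℝ (Fin n ⊕ Fin n)

/-- Componentwise complex conjugation on `ℂⁿ`. -/
def conjVec {n : ℕ} (x : Cn n) : Cn n := WithLp.toLp 2 (fun j => (starRingEnd ℂ) (x j))

/-- The real coordinate directions of `ℂⁿ`: `∂/∂Re x_j` and `∂/∂Im x_j`. -/
def reIm (n : ℕ) : Fin n ⊕ Fin n → Cn n :=
  Sum.elim (fun j => EuclideanSpace.single j (1 : ℂ)) (fun j => EuclideanSpace.single j Complex.I)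

/-- The real coordinate directions of `ℂⁿ × ℂⁿ`. -/
def reIm₂ (n : ℕ) : (Fin n ⊕ Fin n) ⊕ (Fin n ⊕ Fin n) → Cn n × Cn n :=
  Sum.elim (fun k => (reIm n k, 0)) (fun k => (0, reIm n k))

section Gevrey

variable {ι E F : Type*} [Fintype ι] [DecidableEq ι] [NormedAddCommGroup E] [NormedSpace ℝ E]
  [NormedAddCommGroup F] [NormedSpace ℝ F]

/-- `|∂^α u(x)| ≤ B C^|α| (α!)^s` for all `x ∈ U` and all multi-indices `α`, the partial derivatives
being taken in the coordinate directions `b`. A multi-index of length `m` is given by a word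
`v : Fin m → ι` in the coordinates; `α_i` is the number of occurrences of `i` in `v`. -/
def GevreyBound (b : ι → E) (s B C : ℝ) (u : E → F) (U : Set E) : Prop :=
  ∀ x ∈ U, ∀ (m : ℕ) (v : Fin m → ι),
    ‖iteratedFDeriv ℝ m u x (fun k => b (v k))‖ ≤
      B * C ^ m * ∏ i : ι, ((Nat.factorial (Finset.univ.filter (fun k => v k = i)).card : ℝ)) ^ s

/-- The local Gevrey class `𝒢^s(U)`. -/
def IsGevrey (b : ι → E) (s : ℝ) (u : E → F) (U : Set E) : Prop :=
  ContDiffOn ℝ ∞ u U ∧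
    ∀ Q : Set E, IsCompact Q → Q ⊆ U → ∃ B > 0, ∃ C > 0, GevreyBound b s B C u Q

/-- The global Gevrey class `𝒢_b^s(U)`. -/
def IsGevreyB (b : ι → E) (s : ℝ) (u : E → F) (U : Set E) : Prop :=
  ContDiffOn ℝ ∞ u U ∧ ∃ B > 0, ∃ C > 0, GevreyBound b s B C u U

end Gevrey

section Wirtinger

variable {E : Type*} [NormedAddCommGroup E] [NormedSpace ℝ E]

/-- `½ (∂_v - i ∂_w) f`; here `v`, `w` are the directions `∂/∂Re ζ`, `∂/∂Im ζ` of a complex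
coordinate `ζ`, and this is `∂f/∂ζ`. -/
def del (v w : E) (f : E → ℂ) (p : E) : ℂ :=
  (fderiv ℝ f p v - Complex.I * fderiv ℝ f p w) / 2

/-- `½ (∂_v + i ∂_w) f`, that is `∂f/∂ζ̄`. -/
def dbar (v w : E) (f : E → ℂ) (p : E) : ℂ :=
  (fderiv ℝ f p v + Complex.I * fderiv ℝ f p w) / 2

end Wirtinger

/-- The Levi form `∑ ∂²Φ/∂x_j∂x̄_k ξ_j ξ̄_k` at `x`. -/
def leviForm {n : ℕ} (Φ : Cn n → ℝ) (x ξ : Cn n) : ℂ :=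
  ∑ j : Fin n, ∑ k : Fin n,
    del (reIm n (Sum.inl j)) (reIm n (Sum.inr j))
        (dbar (reIm n (Sum.inl k)) (reIm n (Sum.inr k)) (fun t => (Φ t : ℂ))) x
      * ξ j * (starRingEnd ℂ) (ξ k)

/-- Strict plurisubharmonicity of a smooth function. -/
def StrictlyPSH {n : ℕ} (Φ : Cn n → ℝ) (Ω : Set (Cn n)) : Prop :=
  ∃ c : Cn n → ℝ, ContinuousOn c Ω ∧ (∀ x ∈ Ω, 0 < c x) ∧
    ∀ x ∈ Ω, ∀ ξ : Cn n, c x * ‖ξ‖ ^ 2 ≤ (leviForm Φ x ξ).re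

/-- `{(x + z, x̄ - z̄) : x ∈ U, |z| < ρ}`, a neighbourhood of the anti-diagonal over `U`. -/
def tube {n : ℕ} (U : Set (Cn n)) (ρ : ℝ) : Set (Cn n × Cn n) :=
  {p | ∃ x ∈ U, ∃ z : Cn n, ‖z‖ < ρ ∧ p = (x + z, conjVec x - conjVec z)}

/-- `C exp(-C⁻¹ t^{-1/(s-1)})`, with the value `0` at `t = 0`. -/
def flatWeight (s C t : ℝ) : ℝ :=
  if t = 0 then 0 else C * Real.exp (-(C⁻¹ * t ^ (-(1 / (s - 1)))))

/-- Every `∂f/∂x̄_j` and every `∂f/∂ȳ_j` is bounded by `C exp(-C⁻¹ |x - ȳ|^{-1/(s-1)})` on `T`. -/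
def DbarFlat {n : ℕ} (s C : ℝ) (f : Cn n × Cn n → ℂ) (T : Set (Cn n × Cn n)) : Prop :=
  ∀ p ∈ T, ∀ j : Fin n,
    ‖dbar (reIm n (Sum.inl j), (0 : Cn n)) (reIm n (Sum.inr j), 0) f p‖
        ≤ flatWeight s C ‖p.1 - conjVec p.2‖ ∧
    ‖dbar ((0 : Cn n), reIm n (Sum.inl j)) (0, reIm n (Sum.inr j)) f p‖
        ≤ flatWeight s C ‖p.1 - conjVec p.2‖

/-- `Ψ ∈ 𝒢_b^s(T)` with `T = tube U ρ` is a polarization of `Φ`, almost holomorphic along the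
anti-diagonal. -/
structure IsPolarization {n : ℕ} (s : ℝ) (Φ : Cn n → ℝ) (U : Set (Cn n)) (ρ : ℝ)
    (Ψ : Cn n × Cn n → ℂ) : Prop where
  gevrey : IsGevreyB (reIm₂ n) s Ψ (tube U ρ)
  diag : ∀ x ∈ U, Ψ (x, conjVec x) = (Φ x : ℂ)
  flat : ∃ C > 0, DbarFlat s C Ψ (tube U ρ)

/-- A Gevrey amplitude `a(x, ỹ; h)`, `0 < h ≤ h₀`, on `T`: it has an asymptotic expansion
`∑ a_j h^j` with remainders
`|∂^α (a - ∑_{j<N} a_j h^j)| ≤ C^{1+|α|+N} (α!)^s (N!)^{2s-1} h^N`, and a flat `∂̄`, uniformly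
in `h`. -/
structure IsGevreyAmplitude {n : ℕ} (s h₀ : ℝ) (T : Set (Cn n × Cn n))
    (a : ℝ → Cn n × Cn n → ℂ) : Prop where
  smooth : ∀ h, 0 < h → h ≤ h₀ → ContDiffOn ℝ ∞ (a h) T
  expansion : ∃ aj : ℕ → Cn n × Cn n → ℂ, (∀ j, ContDiffOn ℝ ∞ (aj j) T) ∧
    ∃ C > 0, ∀ h, 0 < h → h ≤ h₀ → ∀ N : ℕ,
      GevreyBound (reIm₂ n) s
        (C ^ (1 + N) * ((Nat.factorial N : ℝ)) ^ (2 * s - 1) * h ^ N) C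
        (fun p => a h p - ∑ j ∈ Finset.range N, aj j p * (h : ℂ) ^ j) T
  flat : ∃ C > 0, ∀ h, 0 < h → h ≤ h₀ → DbarFlat s C (a h) T

/-- `φ(y, x̃; x, ỹ) = Ψ(x, ỹ) - Ψ(x, x̃) - Ψ(y, ỹ) + Ψ(y, x̃)`; the first argument is `(y, x̃)`, the
second `(x, ỹ)`. -/
def phase {n : ℕ} (Ψ : Cn n × Cn n → ℂ) (q p : Cn n × Cn n) : ℂ :=
  Ψ (p.1, p.2) - Ψ (p.1, q.2) - Ψ (q.1, p.2) + Ψ (q.1, q.2)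

/-- A family of parametrized `2n`-dimensional contours in `ℂⁿ × ℂⁿ`, indexed by `y ∈ ℂⁿ`:
`Γ(y) = {map y t : t ∈ dom}`. -/
structure Contour (n : ℕ) where
  dom : Set (R2n n)
  map : Cn n → R2n n → Cn n × Cn n

/-- The derivative of the parametrization of `Γ(y)` at `t` in the `k`-th coordinate direction. -/
def Contour.partial {n : ℕ} (Γ : Contour n) (y : Cn n) (t : R2n n) (k : Fin n ⊕ Fin n) :
    Cn n × Cn n :=
  fderiv ℝ (Γ.map y) t (EuclideanSpace.single k (1 : ℝ))

/-- The complex Jacobian determinant of the parametrization: the pull-back of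
`dx_1 ∧ … ∧ dx_n ∧ dỹ_1 ∧ … ∧ dỹ_n` is this function times
`dt_{inl 1} ∧ … ∧ dt_{inl n} ∧ dt_{inr 1} ∧ … ∧ dt_{inr n}`. -/
def Contour.jac {n : ℕ} (Γ : Contour n) (y : Cn n) (t : R2n n) : ℂ :=
  (Matrix.of fun i k : Fin n ⊕ Fin n =>
    Sum.elim (fun j => (Γ.partial y t k).1 j) (fun j => (Γ.partial y t k).2 j) i).det

/-- The real Jacobian matrix at `t = 0` of `t ↦ x - conj ỹ`, `(x, ỹ) = Γ.map y t`. -/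
def Contour.orientMatrix {n : ℕ} (Γ : Contour n) (y : Cn n) :
    Matrix (Fin n ⊕ Fin n) (Fin n ⊕ Fin n) ℝ :=
  Matrix.of fun i k =>
    Sum.elim
      (fun j => ((Γ.partial y 0 k).1 j - (starRingEnd ℂ) ((Γ.partial y 0 k).2 j)).re)
      (fun j => ((Γ.partial y 0 k).1 j - (starRingEnd ℂ) ((Γ.partial y 0 k).2 j)).im) i

/-- `Γ(y) = Γ(y, ȳ)`, `y ∈ L`, is a family of good contours, with constant `K`, for the phases
`(x, ỹ) ↦ φ(y, ȳ; x, ỹ)`, where `φ` comes from a function `Ψ` on `T`.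

A contour carries an orientation, here the one of its parametrization; `oriented` normalizes it to
be that of the affine contour `z ↦ (y + z, ȳ - z̄)`, for which `x - conj ỹ = 2z`. -/
structure IsGoodContour {n : ℕ} (T : Set (Cn n × Cn n)) (Ψ : Cn n × Cn n → ℂ) (K : ℝ)
    (L : Set (Cn n)) (Γ : Contour n) : Prop where
  compact_dom : IsCompact Γ.dom
  dom_nhds : Γ.dom ∈ nhds (0 : R2n n)
  smooth : ∃ O : Set (Cn n × R2n n), IsOpen O ∧ L ×ˢ Γ.dom ⊆ O ∧
    ContDiffOn ℝ ∞ (fun p : Cn n × R2n n => Γ.map p.1 p.2) O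
  injective : ∀ y ∈ L, Set.InjOn (Γ.map y) Γ.dom
  immersion : ∀ y ∈ L, ∀ t ∈ Γ.dom, Function.Injective (fderiv ℝ (Γ.map y) t)
  center : ∀ y ∈ L, Γ.map y 0 = (y, conjVec y)
  oriented : ∀ y ∈ L, 0 < (Γ.orientMatrix y).det
  /-- The contour stays where the phase and the amplitude are defined. -/
  mem_domain : ∀ y ∈ L, ∀ t ∈ Γ.dom, Γ.map y t ∈ T ∧ ((Γ.map y t).1, conjVec y) ∈ T ∧
    (y, (Γ.map y t).2) ∈ T ∧ (y, conjVec y) ∈ T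
  good : ∀ y ∈ L, ∀ t ∈ Γ.dom,
    (phase Ψ (y, conjVec y) (Γ.map y t)).re ≤
      -(K⁻¹ * (‖(Γ.map y t).1 - y‖ ^ 2 + ‖(Γ.map y t).2 - conjVec y‖ ^ 2))

/-- `(A_Γ a)(y, ȳ; h) = (2ih)^{-n} ∫_{Γ(y)} e^{2φ(y, ȳ; x, ỹ)/h} a(x, ỹ; h) dx dỹ`. -/
def contourOp {n : ℕ} (Ψ : Cn n × Cn n → ℂ) (Γ : Contour n) (a : ℝ → Cn n × Cn n → ℂ)
    (y : Cn n) (h : ℝ) : ℂ :=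
  (1 / (2 * Complex.I * (h : ℂ)) ^ n) *
    ∫ t in Γ.dom,
      Complex.exp (2 / (h : ℂ) * phase Ψ (y, conjVec y) (Γ.map y t)) * a h (Γ.map y t) * Γ.jac y t

end GevreyBergman

end

open scoped ContDiff

noncomputable section

/-! Both operators are compared with the same integral over a small disc of the affine contour `z ↦
(y + z, ȳ - z̄)`. Write a point of a good contour as `(y, ȳ)` plus the sum of its components `(z,
-z̄)` and `(w, w̄)`, and scale the second component by `σ`, with `σ` going from `1` to `0`. If the
integrand were holomorphic, Stokes' formula would leave only boundary terms. Those sit where the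
phase is bounded away from `0`, so they are `exp(-c/h)`.

The contraction is harmless for the phase. At `(y, ȳ)` the Hessian of `Ψ` is complex bilinear, since
`∂̄Ψ` vanishes to second order there, and it is real on anti-diagonal vectors, since `Ψ = Φ` there.
Hence the quadratic part of `Re φ` along the contraction is `σ² L(w) - L(z)`, where `L` is the Levi
form (`IsPolarHessian.re_homotopy`). As `L ≥ 0`, this is largest at `σ = 1`, where the good contour
estimate holds. The Taylor error costs half of the constant (`exists_phase_contract_le`).

The integrand is only almost holomorphic. Cramer's rule isolates its antilinear derivative as the
sole interior error in Stokes' formula (`divergence_identity`, `norm_integral_homotopy_sub_le`). If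
`d` is the distance from the original contour point to `(y, ȳ)`, this error is at most a constant
times `h⁻¹ exp(-d²/(Kh)) exp(-c d^{-1/(s-1)})`. The two exponents balance at `d = h^{(s-1)/(2s-1)}`,
which yields `exp(-c h^{-1/(2s-1)})` (`gauss_mul_flatWeight_le`). Half of the exponent absorbs the
powers of `1/h`.

At `σ = 0` the contour is parametrized by the offset `x - conj ỹ`. The orientation and the inverse
function theorem make the offset an orientation-preserving chart near the centre, so a change of
variables gives the integral over the affine disc (`norm_contour_integral_sub_le`). All radii are
uniform for `y` near a given point, and compactness of the closure of `V` gives uniformity. -/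

namespace GevreyBergman

set_option linter.unusedSectionVars false
set_option maxSynthPendingDepth 3

/-! ### Elementary estimates for stretched exponentials. -/

section RealEstimates

/-- The balance between a Gaussian of width `√h` and a Gevrey-flat weight. -/
theorem min_mul_rpow_le_gauss_add_flat {s A B d h : ℝ} (hs : 1 < s) (hA : 0 < A) (hB : 0 < B)
    (hd : 0 < d) (hh : 0 < h) :
    min A B * h ^ (-(1 / (2 * s - 1))) ≤ A * d ^ 2 / h + B * d ^ (-(1 / (s - 1))) := by
  have h1 : 0 < s - 1 := by linarith
  have h2 : 0 < 2 * s - 1 := by linarith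
  have hp : 0 < h ^ (-(1 / (2 * s - 1))) := Real.rpow_pos_of_pos hh _
  have hq : 0 < d ^ (-(1 / (s - 1))) := Real.rpow_pos_of_pos hd _
  -- The threshold is the `d` for which `d²/h` and `d^{-1/(s-1)}` coincide. On either side of it,
  -- one of the two terms alone suffices.
  rcases le_total (h ^ ((s - 1) / (2 * s - 1))) d with hle | hle
  · have hpos : 0 < h ^ ((s - 1) / (2 * s - 1)) := Real.rpow_pos_of_pos hh _
    have e1 : (h ^ ((s - 1) / (2 * s - 1))) ^ 2 = h ^ (-(1 / (2 * s - 1))) * h := by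
      rw [← Real.rpow_natCast, ← Real.rpow_mul hh.le]
      nth_rewrite 3 [← Real.rpow_one h]
      rw [← Real.rpow_add hh]
      congr 1
      have h3 := h2.ne'
      push_cast
      rw [div_mul_eq_mul_div, div_eq_iff h3, add_mul, neg_mul, one_div, inv_mul_cancel₀ h3]
      ring
    have e2 : h ^ (-(1 / (2 * s - 1))) * h ≤ d ^ 2 := by
      rw [← e1]; gcongr
    have e3 : h ^ (-(1 / (2 * s - 1))) ≤ d ^ 2 / h := by
      rw [le_div_iff₀ hh]; exact e2
    calc min A B * h ^ (-(1 / (2 * s - 1))) ≤ A * (d ^ 2 / h) := by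
          gcongr; exact min_le_left _ _
      _ ≤ _ := by rw [mul_div_assoc]; nlinarith [mul_pos hB hq]
  · have e1 : h ^ (-(1 / (2 * s - 1))) ≤ d ^ (-(1 / (s - 1))) := by
      have : (h ^ ((s - 1) / (2 * s - 1))) ^ (-(1 / (s - 1))) = h ^ (-(1 / (2 * s - 1))) := by
        rw [← Real.rpow_mul hh.le]
        congr 1
        field_simp
      rw [← this]
      apply Real.rpow_le_rpow_of_nonpos hd hle
      have : 0 < 1 / (s - 1) := by positivity
      linarith
    calc min A B * h ^ (-(1 / (2 * s - 1))) ≤ B * d ^ (-(1 / (s - 1))) := by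
          gcongr; exact min_le_right _ _
      _ ≤ _ := by
          have : 0 ≤ A * d ^ 2 / h := by positivity
          linarith

theorem exists_rpow_le_mul_add {β ε : ℝ} (h0 : 0 < β) (h1 : β < 1) (hε : 0 < ε) :
    ∃ R : ℝ, ∀ u : ℝ, 0 < u → u ^ β ≤ ε * u + R := by
  refine ⟨((ε⁻¹) ^ (1 / (1 - β))) ^ β, fun u hu => ?_⟩
  have h3 : 0 < 1 - β := by linarith
  rcases le_total u ((ε⁻¹) ^ (1 / (1 - β))) with hle | hle
  · have := Real.rpow_le_rpow hu.le hle h0.le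
    have : 0 < ε * u := by positivity
    linarith
  · have e1 : ε⁻¹ ≤ u ^ (1 - β) := by
      have := Real.rpow_le_rpow (by positivity) hle h3.le
      rwa [← Real.rpow_mul (by positivity), one_div_mul_cancel h3.ne', Real.rpow_one] at this
    have e2 : u ^ β * u ^ (1 - β) = u := by
      rw [← Real.rpow_add hu]; simp
    have e3 : 0 < u ^ β := Real.rpow_pos_of_pos hu _
    have e4 : 1 ≤ ε * u ^ (1 - β) := by
      calc 1 = ε * ε⁻¹ := by field_simp
        _ ≤ _ := by gcongr
    have : u ^ β ≤ ε * u := by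
      calc u ^ β = u ^ β * 1 := by ring
        _ ≤ u ^ β * (ε * u ^ (1 - β)) := by gcongr
        _ = ε * (u ^ β * u ^ (1 - β)) := by ring
        _ = ε * u := by rw [e2]
    have : 0 ≤ ((ε⁻¹) ^ (1 / (1 - β))) ^ β := by positivity
    linarith

/-- As `β < 1`, `h^{-β}` is negligible against `1/h`. Contributions from a fixed distance to the
critical point are therefore absorbed in the final error, whatever the constants `c` and `c'`. -/
theorem exists_exp_neg_div_le {β c c' : ℝ} (h0 : 0 < β) (h1 : β < 1) (hc : 0 < c) (hc' : 0 < c') :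
    ∃ M > 0, ∀ h : ℝ, 0 < h → Real.exp (-(c' / h)) ≤ M * Real.exp (-(c * h ^ (-β))) := by
  obtain ⟨R, hR⟩ := exists_rpow_le_mul_add h0 h1 (ε := c' / c) (by positivity)
  refine ⟨Real.exp (c * R), Real.exp_pos _, fun h hh => ?_⟩
  rw [← Real.exp_add, Real.exp_le_exp]
  have := hR h⁻¹ (by positivity)
  rw [Real.inv_rpow hh.le, ← Real.rpow_neg hh.le] at this
  have h4 : c * h ^ (-β) ≤ c * (c' / c * h⁻¹ + R) := by gcongr
  have h5 : c * (c' / c * h⁻¹ + R) = c' / h + c * R := by field_simp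
  linarith

/-- Half of the exponent pays for any power of `1/h`. No upper bound on `β` is imposed, because the
flat weight needs `β = 1/(s-1)`. -/
theorem exists_inv_pow_mul_exp_le {β c : ℝ} (h0 : 0 < β) (hc : 0 < c) (k : ℕ) :
    ∃ M > 0, ∀ h : ℝ, 0 < h →
      h⁻¹ ^ k * Real.exp (-(2 * c * h ^ (-β))) ≤ M * Real.exp (-(c * h ^ (-β))) := by
  obtain ⟨m, hm⟩ := exists_nat_ge (k / β)
  refine ⟨1 + m.factorial / c ^ m, by positivity, fun h hh => ?_⟩
  set x := h ^ (-β) with hx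
  have hx0 : 0 < x := Real.rpow_pos_of_pos hh _
  have e1 : h⁻¹ ^ k = x ^ (k / β) := by
    rw [hx, ← Real.rpow_mul hh.le, ← Real.rpow_natCast, Real.inv_rpow hh.le, ← Real.rpow_neg hh.le]
    congr 1
    field_simp
  have e2 : h⁻¹ ^ k ≤ 1 + x ^ m := by
    rw [e1]
    rcases le_total x 1 with h1 | h1
    · have := Real.rpow_le_one hx0.le h1 (z := k / β) (by positivity)
      have : 0 ≤ x ^ m := by positivity
      linarith
    · have := Real.rpow_le_rpow_of_exponent_le h1 hm
      rw [Real.rpow_natCast] at this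
      linarith
  have e3 : (c * x) ^ m ≤ m.factorial * Real.exp (c * x) := by
    have := Real.pow_div_factorial_le_exp (c * x) (by positivity) m
    rwa [div_le_iff₀' (by positivity)] at this
  have e4 : x ^ m ≤ m.factorial / c ^ m * Real.exp (c * x) := by
    rw [div_mul_eq_mul_div, le_div_iff₀ (by positivity), ← mul_pow, mul_comm x]
    exact e3
  have e5 : (1 : ℝ) ≤ Real.exp (c * x) := Real.one_le_exp (by positivity)
  have e6 : h⁻¹ ^ k ≤ (1 + m.factorial / c ^ m) * Real.exp (c * x) := by linarith
  calc h⁻¹ ^ k * Real.exp (-(2 * c * x))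
      ≤ (1 + m.factorial / c ^ m) * Real.exp (c * x) * Real.exp (-(2 * c * x)) := by gcongr
    _ = (1 + m.factorial / c ^ m) * Real.exp (-(c * x)) := by
        rw [mul_assoc, ← Real.exp_add]; congr 2; ring

end RealEstimates

/-! ### The pointwise Stokes identity for forms that are not quite holomorphic. -/

section Stokes

open MeasureTheory

variable {ι E : Type*} [Fintype ι] [DecidableEq ι] [NormedAddCommGroup E] [NormedSpace ℝ E]
  [NormedSpace ℂ E] [IsScalarTower ℝ ℂ E]

/-- The antilinear part of a real-linear functional. -/
def antiPart (L : E →L[ℝ] ℂ) (v : E) : ℂ := (L v + Complex.I * L (Complex.I • v)) / 2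

/-- The complex-linear part of a real-linear functional. -/
def linPart (L : E →L[ℝ] ℂ) (v : E) : ℂ := (L v - Complex.I * L (Complex.I • v)) / 2

theorem linPart_add_antiPart (L : E →L[ℝ] ℂ) (v : E) : linPart L v + antiPart L v = L v := by
  simp only [linPart, antiPart]; ring

theorem complex_smul_eq (z : ℂ) (v : E) : z • v = z.re • v + z.im • (Complex.I • v) := by
  conv_lhs => rw [← Complex.re_add_im z]
  rw [add_smul, mul_smul]
  simp only [← Complex.coe_algebraMap, algebraMap_smul]

theorem linPart_add (L : E →L[ℝ] ℂ) (v w : E) : linPart L (v + w) = linPart L v + linPart L w := by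
  simp only [linPart, smul_add, map_add]; ring

theorem antiPart_add (L : E →L[ℝ] ℂ) (v w : E) :
    antiPart L (v + w) = antiPart L v + antiPart L w := by
  simp only [antiPart, smul_add, map_add]; ring

theorem linPart_smul (L : E →L[ℝ] ℂ) (z : ℂ) (v : E) : linPart L (z • v) = z * linPart L v := by
  have h2 : Complex.I • (z • v) = z.re • (Complex.I • v) - z.im • v := by
    rw [smul_comm, complex_smul_eq z (Complex.I • v), smul_smul Complex.I Complex.I v]
    simp [sub_eq_add_neg]
  have hI := Complex.I_sq
  simp only [linPart]
  rw [h2, complex_smul_eq z v]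
  simp only [map_add, map_sub, map_smul, Complex.real_smul]
  conv_rhs => rw [← Complex.re_add_im z]
  linear_combination ((z.im : ℂ) * L (Complex.I • v) / 2) * hI

theorem antiPart_smul (L : E →L[ℝ] ℂ) (z : ℂ) (v : E) :
    antiPart L (z • v) = (starRingEnd ℂ) z * antiPart L v := by
  have h2 : Complex.I • (z • v) = z.re • (Complex.I • v) - z.im • v := by
    rw [smul_comm, complex_smul_eq z (Complex.I • v), smul_smul Complex.I Complex.I v]
    simp [sub_eq_add_neg]
  have hI := Complex.I_sq
  have hc : (starRingEnd ℂ) z = z.re - z.im * Complex.I := by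
    apply Complex.ext <;> simp
  simp only [antiPart]
  rw [h2, complex_smul_eq z v, hc]
  simp only [map_add, map_sub, map_smul, Complex.real_smul]
  linear_combination ((z.im : ℂ) * L (Complex.I • v) / 2) * hI

theorem linPart_sum {κ : Type*} (L : E →L[ℝ] ℂ) (t : Finset κ) (f : κ → E) :
    linPart L (∑ k ∈ t, f k) = ∑ k ∈ t, linPart L (f k) :=
  map_sum (AddMonoidHom.mk' (linPart L) (linPart_add L)) f t

theorem antiPart_sum {κ : Type*} (L : E →L[ℝ] ℂ) (t : Finset κ) (f : κ → E) :
    antiPart L (∑ k ∈ t, f k) = ∑ k ∈ t, antiPart L (f k) :=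
  map_sum (AddMonoidHom.mk' (antiPart L) (antiPart_add L)) f t

/-- An alternating form satisfying Cramer's rule over `ℂ`, as the complex determinant does. -/
def SatisfiesCramer (D : E [⋀^ι]→L[ℝ] ℂ) : Prop :=
  ∀ (c : ι → E) (v : E), D c • v = ∑ k, D (Function.update c k v) • c k

/-- Applying the complex-linear part of `L` to Cramer's identity shows that it contributes nothing.
This is the closedness of `F dx ∧ dỹ` for holomorphic `F`, with the defect made explicit. -/
theorem SatisfiesCramer.apply_sub_sum {D : E [⋀^ι]→L[ℝ] ℂ} (hD : SatisfiesCramer D)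
    (L : E →L[ℝ] ℂ) (c : ι → E) (v : E) :
    L v * D c - ∑ k, L (c k) * D (Function.update c k v) =
      antiPart L v * D c - ∑ k, antiPart L (c k) * D (Function.update c k v) := by
  have h := congrArg (linPart L) (hD c v)
  rw [linPart_smul, linPart_sum] at h
  simp only [linPart_smul] at h
  simp only [← linPart_add_antiPart L, add_mul, Finset.sum_add_distrib]
  simp only [mul_comm (linPart L _)]
  rw [h]; ring

/-- The mixed second-order terms of the divergence cancel in pairs. -/
theorem sum_update_update_eq_zero (D : E [⋀^ι]→L[ℝ] ℂ) (c : ι → E) (v : E) (S : ι → ι → E)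
    (hS : ∀ k l, S k l = S l k) :
    ∑ k, ∑ l ∈ Finset.univ.erase k,
      D (Function.update (Function.update c k v) l (S k l)) = 0 := by
  have key : ∀ k l, k ≠ l → D (Function.update (Function.update c k v) l (S k l)) =
      - D (Function.update (Function.update c l v) k (S l k)) := by
    intro k l hkl
    have := D.toAlternatingMap.map_swap
      (Function.update (Function.update c l v) k (S l k)) hkl
    simp only [ContinuousAlternatingMap.coe_toAlternatingMap] at this
    rw [← this]
    congr 1
    funext i
    simp only [Function.comp_apply]
    by_cases hi : i = k
    · subst hi
      simp [Equiv.swap_apply_left, Function.update_of_ne hkl, Function.update_of_ne hkl.symm]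
    · by_cases hi' : i = l
      · subst hi'
        simp [Equiv.swap_apply_right, hS k i]
      · rw [Equiv.swap_apply_of_ne_of_ne hi hi']
        simp [Function.update_of_ne hi, Function.update_of_ne hi']
  have e : ∀ f : ι → ι → ℂ, ∑ k, ∑ l ∈ Finset.univ.erase k, f k l =
      ∑ k, ∑ l, if k ≠ l then f k l else 0 := by
    intro f
    refine Finset.sum_congr rfl fun k _ => ?_
    rw [← Finset.sum_filter]
    refine Finset.sum_congr ?_ fun _ _ => rfl
    ext l; simp [eq_comm]
  rw [e]
  set A := ∑ k, ∑ l, if k ≠ l then D (Function.update (Function.update c k v) l (S k l)) else 0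
    with hA
  -- Exchanging the roles of `k` and `l` swaps two arguments of `D`, and `S` is symmetric.
  have : A = -A := by
    conv_lhs => rw [hA, Finset.sum_comm]
    rw [hA, ← Finset.sum_neg_distrib]
    refine Finset.sum_congr rfl fun k _ => ?_
    rw [← Finset.sum_neg_distrib]
    refine Finset.sum_congr rfl fun l _ => ?_
    by_cases hkl : k = l
    · simp [hkl]
    · rw [if_pos (Ne.symm hkl), if_pos hkl, key k l hkl, neg_neg]
  have h2 : (2 : ℂ) * A = 0 := by linear_combination this
  simpa using h2

theorem hasFDerivAt_alternating_comp {X : Type*} [NormedAddCommGroup X]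
    [NormedSpace ℝ X] (D : E [⋀^ι]→L[ℝ] ℂ) {c : ι → X → E} {c' : ι → X →L[ℝ] E} {x : X}
    (hc : ∀ i, HasFDerivAt (c i) (c' i) x) :
    ∃ L : X →L[ℝ] ℂ, HasFDerivAt (fun x => D fun i => c i x) L x ∧
      ∀ v, L v = ∑ i, D (Function.update (fun j => c j x) i (c' i v)) := by
  refine ⟨_, HasFDerivAt.multilinear_comp (f := D.toContinuousMultilinearMap) hc, fun v => ?_⟩
  simp only [_root_.sum_apply, ContinuousLinearMap.comp_apply,
    ContinuousMultilinearMap.toContinuousLinearMap_apply]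
  rfl

/-- The coordinate direction `k` in the parameter space. -/
abbrev dir (k : ι) : EuclideanSpace ℝ ι := EuclideanSpace.single k (1 : ℝ)

/-- Columns of the Jacobian of the homotopy `γ + σ η`. -/
def homCol (γ η : EuclideanSpace ℝ ι → E) (σ : ℝ) (t : EuclideanSpace ℝ ι) (k : ι) : E :=
  fderiv ℝ γ t (dir k) + σ • fderiv ℝ η t (dir k)

/-- The failure of `F` to be holomorphic along the homotopy `γ + σ η`. -/
def stokesErr (D : E [⋀^ι]→L[ℝ] ℂ) (F : E → ℂ) (γ η : EuclideanSpace ℝ ι → E) (σ : ℝ)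
    (t : EuclideanSpace ℝ ι) : ℂ :=
  antiPart (fderiv ℝ F (γ t + σ • η t)) (η t) * D (homCol γ η σ t) -
    ∑ k, antiPart (fderiv ℝ F (γ t + σ • η t)) (homCol γ η σ t k) *
      D (Function.update (homCol γ η σ t) k (η t))

theorem hasFDerivAt_homCol {γ η : EuclideanSpace ℝ ι → E} {t : EuclideanSpace ℝ ι}
    (hγ : ContDiffAt ℝ 2 γ t) (hη : ContDiffAt ℝ 2 η t) (σ : ℝ) (k : ι) :
    ∃ L : EuclideanSpace ℝ ι →L[ℝ] E, HasFDerivAt (fun t => homCol γ η σ t k) L t ∧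
      ∀ l, L (dir l) = fderiv ℝ (fderiv ℝ γ) t (dir l) (dir k) +
        σ • fderiv ℝ (fderiv ℝ η) t (dir l) (dir k) := by
  have h1 : DifferentiableAt ℝ (fderiv ℝ γ) t :=
    (hγ.fderiv_right (m := 1) (by norm_num)).differentiableAt (by norm_num)
  have h2 : DifferentiableAt ℝ (fderiv ℝ η) t :=
    (hη.fderiv_right (m := 1) (by norm_num)).differentiableAt (by norm_num)
  have h3 := (h1.hasFDerivAt.clm_apply (hasFDerivAt_const (dir k) t)).add
    ((h2.hasFDerivAt.clm_apply (hasFDerivAt_const (dir k) t)).const_smul σ)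
  exact ⟨_, h3, fun l => by simp⟩

/-- The divergence identity behind the homotopy invariance of integrals of holomorphic forms. -/
theorem divergence_identity {D : E [⋀^ι]→L[ℝ] ℂ} (hD : SatisfiesCramer D) {F : E → ℂ}
    {γ η : EuclideanSpace ℝ ι → E} {t : EuclideanSpace ℝ ι} {σ : ℝ}
    (hγ : ContDiffAt ℝ 2 γ t) (hη : ContDiffAt ℝ 2 η t)
    (hF : DifferentiableAt ℝ F (γ t + σ • η t)) :
    (∀ k, DifferentiableAt ℝ
      (fun t => F (γ t + σ • η t) * D (Function.update (homCol γ η σ t) k (η t))) t) ∧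
    fderiv ℝ F (γ t + σ • η t) (η t) * D (homCol γ η σ t) + F (γ t + σ • η t) *
        ∑ k, D (Function.update (homCol γ η σ t) k (fderiv ℝ η t (dir k))) =
      ∑ k, fderiv ℝ (fun t => F (γ t + σ • η t) *
        D (Function.update (homCol γ η σ t) k (η t))) t (dir k) + stokesErr D F γ η σ t := by
  choose L hL hL' using fun k => hasFDerivAt_homCol hγ hη σ k
  have dγ : DifferentiableAt ℝ γ t := hγ.differentiableAt (by norm_num)
  have dη : DifferentiableAt ℝ η t := hη.differentiableAt (by norm_num)
  have hFc : HasFDerivAt (fun t => F (γ t + σ • η t))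
      ((fderiv ℝ F (γ t + σ • η t)).comp (fderiv ℝ γ t + σ • fderiv ℝ η t)) t :=
    hF.hasFDerivAt.comp t (dγ.hasFDerivAt.add (dη.hasFDerivAt.const_smul σ))
  have hDk : ∀ k, ∃ M : EuclideanSpace ℝ ι →L[ℝ] ℂ,
      HasFDerivAt (fun t => D (Function.update (homCol γ η σ t) k (η t))) M t ∧
      ∀ v, M v = ∑ l, D (Function.update (Function.update (homCol γ η σ t) k (η t)) l
        (if l = k then fderiv ℝ η t v else L l v)) := by
    intro k
    have := hasFDerivAt_alternating_comp D (x := t)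
      (c := fun l t => Function.update (homCol γ η σ t) k (η t) l)
      (c' := fun l => if l = k then fderiv ℝ η t else L l) (by
        intro l
        by_cases hl : l = k
        · subst hl; simpa using dη.hasFDerivAt
        · simpa [hl, Function.update_of_ne hl] using hL l)
    obtain ⟨M, hM, hM'⟩ := this
    refine ⟨M, hM, fun v => ?_⟩
    rw [hM']
    refine Finset.sum_congr rfl fun l _ => ?_
    congr 2
    split_ifs <;> rfl
  choose M hM hM' using hDk
  have hprod := fun k => hFc.mul (hM k)
  refine ⟨fun k => (hprod k).differentiableAt, ?_⟩
  have hval : ∀ k, fderiv ℝ (fun t => F (γ t + σ • η t) *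
        D (Function.update (homCol γ η σ t) k (η t))) t (dir k) =
      F (γ t + σ • η t) * D (Function.update (homCol γ η σ t) k (fderiv ℝ η t (dir k))) +
      F (γ t + σ • η t) * (∑ l ∈ Finset.univ.erase k,
        D (Function.update (Function.update (homCol γ η σ t) k (η t)) l (L l (dir k)))) +
      fderiv ℝ F (γ t + σ • η t) (homCol γ η σ t k) *
        D (Function.update (homCol γ η σ t) k (η t)) := by
    intro k
    have h0 := (hprod k).fderiv
    have h1 : fderiv ℝ (fun t => F (γ t + σ • η t) *
        D (Function.update (homCol γ η σ t) k (η t))) t (dir k) =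
        F (γ t + σ • η t) * M k (dir k) + D (Function.update (homCol γ η σ t) k (η t)) *
        fderiv ℝ F (γ t + σ • η t) (homCol γ η σ t k) := by
      refine (congrArg (fun A : EuclideanSpace ℝ ι →L[ℝ] ℂ => A (dir k)) h0).trans ?_
      simp [homCol, mul_add]
    rw [h1, hM', ← Finset.add_sum_erase _ _ (Finset.mem_univ k)]
    simp only [if_true, Function.update_idem]
    rw [Finset.sum_congr rfl (g := fun l => D (Function.update
      (Function.update (homCol γ η σ t) k (η t)) l (L l (dir k))))
      (fun l hl => by rw [if_neg (Finset.ne_of_mem_erase hl)])]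
    ring
  rw [Finset.sum_congr rfl fun k _ => hval k, Finset.sum_add_distrib, Finset.sum_add_distrib,
    ← Finset.mul_sum, ← Finset.mul_sum]
  -- The derivatives of the columns are second derivatives of `γ` and `η`, so their symmetry makes
  -- these terms cancel. What remains is first order in `F`, and Cramer's rule reduces it to its
  -- antilinear part.
  have hz := sum_update_update_eq_zero D (homCol γ η σ t) (η t) (fun k l => L l (dir k)) (by
    intro k l
    rw [hL', hL']
    have s1 : IsSymmSndFDerivAt ℝ γ t := hγ.isSymmSndFDerivAt (by simp)
    have s2 : IsSymmSndFDerivAt ℝ η t := hη.isSymmSndFDerivAt (by simp)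
    rw [s1, s2])
  rw [hz, stokesErr]
  have := hD.apply_sub_sum (fderiv ℝ F (γ t + σ • η t)) (homCol γ η σ t) (η t)
  linear_combination this

end Stokes

/-! ### The integrated homotopy estimate with a cut-off. -/

section StokesIntegral

open MeasureTheory Set

variable {ι E : Type*} [Fintype ι] [DecidableEq ι] [NormedAddCommGroup E] [NormedSpace ℝ E]
  [NormedSpace ℂ E] [IsScalarTower ℝ ℂ E]

theorem continuous_smul_of_tsupport_subset {X G : Type*} [TopologicalSpace X]
    [NormedAddCommGroup G] [NormedSpace ℝ G] {θ : X → ℝ} {g : X → G} {W : Set X} (hW : IsOpen W)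
    (hθ : Continuous θ) (hS : tsupport θ ⊆ W) (hg : ContinuousOn g W) :
    Continuous fun t => θ t • g t := by
  refine continuous_of_tsupport fun t ht => ?_
  have : t ∈ W := hS (closure_mono (Function.support_smul_subset_left θ g) ht)
  exact hθ.continuousAt.smul (hg.continuousAt (hW.mem_nhds this))

theorem integrable_smul_of_tsupport_subset {θ : EuclideanSpace ℝ ι → ℝ}
    {g : EuclideanSpace ℝ ι → ℂ} {W : Set (EuclideanSpace ℝ ι)} (hW : IsOpen W)
    (hθ : Continuous θ) (hc : HasCompactSupport θ) (hS : tsupport θ ⊆ W) (hg : ContinuousOn g W) :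
    Integrable fun t => θ t • g t :=
  (continuous_smul_of_tsupport_subset hW hθ hS hg).integrable_of_hasCompactSupport hc.smul_right

theorem ContinuousOn.update_pi {X G : Type*} [TopologicalSpace X] [TopologicalSpace G]
    {f : X → ι → G} {g : X → G} {A : Set X} (k : ι) (hf : ContinuousOn f A)
    (hg : ContinuousOn g A) : ContinuousOn (fun x => Function.update (f x) k (g x)) A := by
  refine continuousOn_pi.2 fun i => ?_
  by_cases hi : i = k
  · subst hi; simpa using hg
  · simpa [Function.update_of_ne hi] using continuousOn_pi.1 hf i

/-- The derivative of the integral in `σ` is a divergence plus `stokesErr`. Integration by parts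
moves the divergence onto `θ`, and the mean value inequality on `[0, 1]` concludes. The parameter
interval `(-1, 2)` leaves room for two-sided derivatives at both ends. -/
theorem norm_integral_homotopy_sub_le {D : E [⋀^ι]→L[ℝ] ℂ} (hD : SatisfiesCramer D) {F : E → ℂ}
    {γ η : EuclideanSpace ℝ ι → E} {W : Set (EuclideanSpace ℝ ι)} (hW : IsOpen W)
    {T : Set E} (hT : IsOpen T) (hγ : ContDiffOn ℝ 2 γ W) (hη : ContDiffOn ℝ 2 η W)
    (hF : ContDiffOn ℝ 1 F T)
    (hmem : ∀ σ ∈ Ioo (-1 : ℝ) 2, ∀ t ∈ W, γ t + σ • η t ∈ T)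
    {θ : EuclideanSpace ℝ ι → ℝ} (hθ : ContDiff ℝ 1 θ) (hc : HasCompactSupport θ)
    (hS : tsupport θ ⊆ W) {Q : ℝ}
    (hQ : ∀ σ ∈ Icc (0 : ℝ) 1, ∀ t ∈ tsupport θ,
      ‖θ t • stokesErr D F γ η σ t - ∑ k, fderiv ℝ θ t (dir k) •
        (F (γ t + σ • η t) * D (Function.update (homCol γ η σ t) k (η t)))‖ ≤ Q) :
    ‖(∫ t, θ t • (F (γ t + (1 : ℝ) • η t) * D (homCol γ η 1 t))) -
      ∫ t, θ t • (F (γ t + (0 : ℝ) • η t) * D (homCol γ η 0 t))‖ ≤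
      Q * volume.real (tsupport θ) := by
  set I : Set ℝ := Ioo (-1 : ℝ) 2
  have hIo : IsOpen I := isOpen_Ioo
  have c1 : ContinuousOn (fun p : ℝ × EuclideanSpace ℝ ι => γ p.2 + p.1 • η p.2) (I ×ˢ W) :=
    (hγ.continuousOn.comp continuousOn_snd fun p hp => hp.2).add
      (continuousOn_fst.smul (hη.continuousOn.comp continuousOn_snd fun p hp => hp.2))
  have c1m : MapsTo (fun p : ℝ × EuclideanSpace ℝ ι => γ p.2 + p.1 • η p.2) (I ×ˢ W) T :=
    fun p hp => hmem p.1 hp.1 p.2 hp.2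
  have cη : ContinuousOn (fun p : ℝ × EuclideanSpace ℝ ι => η p.2) (I ×ˢ W) :=
    hη.continuousOn.comp continuousOn_snd fun p hp => hp.2
  have cFγ := hF.continuousOn.comp c1 c1m
  have cdF : ContinuousOn (fun p : ℝ × EuclideanSpace ℝ ι =>
      fderiv ℝ F (γ p.2 + p.1 • η p.2)) (I ×ˢ W) :=
    (hF.continuousOn_fderiv_of_isOpen hT (by norm_num)).comp c1 c1m
  have cdγ : ContinuousOn (fun p : ℝ × EuclideanSpace ℝ ι => fderiv ℝ γ p.2) (I ×ˢ W) :=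
    (hγ.continuousOn_fderiv_of_isOpen hW (by norm_num)).comp continuousOn_snd fun p hp => hp.2
  have cdη : ContinuousOn (fun p : ℝ × EuclideanSpace ℝ ι => fderiv ℝ η p.2) (I ×ˢ W) :=
    (hη.continuousOn_fderiv_of_isOpen hW (by norm_num)).comp continuousOn_snd fun p hp => hp.2
  have chc : ContinuousOn (fun p : ℝ × EuclideanSpace ℝ ι => homCol γ η p.1 p.2) (I ×ˢ W) :=
    continuousOn_pi.2 fun k => (cdγ.clm_apply continuousOn_const).add
      (continuousOn_fst.smul (cdη.clm_apply continuousOn_const))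
  have cDu : ∀ {g : ℝ × EuclideanSpace ℝ ι → E} (k : ι), ContinuousOn g (I ×ˢ W) →
      ContinuousOn (fun p : ℝ × EuclideanSpace ℝ ι =>
        D (Function.update (homCol γ η p.1 p.2) k (g p))) (I ×ˢ W) := fun k hg =>
    D.cont.comp_continuousOn (ContinuousOn.update_pi k chc hg)
  set G : ℝ → EuclideanSpace ℝ ι → ℂ := fun σ t => F (γ t + σ • η t) * D (homCol γ η σ t) with hG
  set G' : ℝ → EuclideanSpace ℝ ι → ℂ := fun σ t =>
    fderiv ℝ F (γ t + σ • η t) (η t) * D (homCol γ η σ t) + F (γ t + σ • η t) *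
        ∑ k, D (Function.update (homCol γ η σ t) k (fderiv ℝ η t (dir k))) with hG'
  have cG : ContinuousOn (fun p : ℝ × EuclideanSpace ℝ ι => G p.1 p.2) (I ×ˢ W) :=
    cFγ.mul (D.cont.comp_continuousOn chc)
  have cG' : ContinuousOn (fun p : ℝ × EuclideanSpace ℝ ι => G' p.1 p.2) (I ×ˢ W) :=
    ((cdF.clm_apply cη).mul (D.cont.comp_continuousOn chc)).add
      (cFγ.mul (continuousOn_finsetSum _ fun k _ =>
        cDu k (cdη.clm_apply continuousOn_const)))
  have slice : ∀ {g : ℝ × EuclideanSpace ℝ ι → ℂ}, ContinuousOn g (I ×ˢ W) → ∀ σ ∈ I,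
      ContinuousOn (fun t => g (σ, t)) W := fun hg σ hσ =>
    hg.comp (by fun_prop) fun t ht => ⟨hσ, ht⟩
  -- derivative in the homotopy parameter
  have hder : ∀ t ∈ W, ∀ σ ∈ I, HasDerivAt (fun σ => G σ t) (G' σ t) σ := by
    intro t ht σ hσ
    have hFd : HasFDerivAt F (fderiv ℝ F (γ t + σ • η t)) (γ t + σ • η t) :=
      ((hF.contDiffAt (hT.mem_nhds (hmem σ hσ t ht))).differentiableAt (by norm_num)).hasFDerivAt
    have h1 : HasDerivAt (fun σ : ℝ => γ t + σ • η t) (η t) σ := by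
      simpa using ((hasDerivAt_id σ).smul_const (η t)).const_add (γ t)
    have h2 := hFd.comp_hasDerivAt σ h1
    obtain ⟨L, hL, hL'⟩ := hasFDerivAt_alternating_comp D (x := σ)
      (c := fun k σ => homCol γ η σ t k)
      (c' := fun k => (1 : ℝ →L[ℝ] ℝ).smulRight (fderiv ℝ η t (dir k))) (fun k => by
        have : HasDerivAt (fun σ : ℝ => homCol γ η σ t k) (fderiv ℝ η t (dir k)) σ := by
          simpa [homCol] using
            ((hasDerivAt_id σ).smul_const (fderiv ℝ η t (dir k))).const_add (fderiv ℝ γ t (dir k))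
        exact this.hasFDerivAt)
    have h3 := h2.mul hL.hasDerivAt
    refine h3.congr_deriv ?_
    rw [hL']
    simp [hG']
  -- The dominating constant for differentiation under the integral comes from compactness of a
  -- parameter interval that contains `[0, 1]` in its interior.
  have hbdd : ∃ R, ∀ σ ∈ Icc (-(1 / 2) : ℝ) (3 / 2), ∀ t ∈ tsupport θ, ‖θ t • G' σ t‖ ≤ R := by
    obtain ⟨R, hR⟩ := ((isCompact_Icc (a := (-(1 / 2) : ℝ)) (b := 3 / 2)).prod hc).exists_bound_of_continuousOn
      (f := fun p : ℝ × EuclideanSpace ℝ ι => θ p.2 • G' p.1 p.2)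
      ((hθ.continuous.comp continuous_snd).continuousOn.smul (cG'.mono (prod_mono (by
        intro σ hσ; exact ⟨by linarith [hσ.1], by linarith [hσ.2]⟩) hS)))
    exact ⟨R, fun σ hσ t ht => hR (σ, t) ⟨hσ, ht⟩⟩
  obtain ⟨R, hR⟩ := hbdd
  have hzero : ∀ t ∉ tsupport θ, θ t = 0 := fun t ht => image_eq_zero_of_notMem_tsupport ht
  have hIcc : ∀ σ ∈ Icc (0 : ℝ) 1, σ ∈ I := fun σ hσ => ⟨by linarith [hσ.1], by linarith [hσ.2]⟩
  have hint : ∀ σ ∈ Icc (0 : ℝ) 1, HasDerivAt (fun σ => ∫ t, θ t • G σ t)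
      (∫ t, θ t • G' σ t) σ := by
    intro σ hσ
    have hnhds : Ioo (-(1 / 2) : ℝ) (3 / 2) ∈ nhds σ :=
      Ioo_mem_nhds (by linarith [hσ.1]) (by linarith [hσ.2])
    refine (hasDerivAt_integral_of_dominated_loc_of_deriv_le (μ := volume)
      (F := fun σ t => θ t • G σ t) (F' := fun σ t => θ t • G' σ t)
      (bound := (tsupport θ).indicator fun _ => |R|) hnhds ?_ ?_ ?_ ?_ ?_ ?_).2
    · filter_upwards [hIo.mem_nhds (hIcc σ hσ)] with τ hτ
      exact (integrable_smul_of_tsupport_subset hW hθ.continuous hc hS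
        (slice cG τ hτ)).aestronglyMeasurable
    · exact integrable_smul_of_tsupport_subset hW hθ.continuous hc hS (slice cG σ (hIcc σ hσ))
    · exact (integrable_smul_of_tsupport_subset hW hθ.continuous hc hS
        (slice cG' σ (hIcc σ hσ))).aestronglyMeasurable
    · refine Filter.Eventually.of_forall fun t τ hτ => ?_
      by_cases ht : t ∈ tsupport θ
      · rw [indicator_of_mem ht]
        exact (hR τ (Ioo_subset_Icc_self hτ) t ht).trans (le_abs_self R)
      · rw [indicator_of_notMem ht]; simp [hzero t ht]
    · exact (integrable_indicator_iff hc.measurableSet).2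
        (integrableOn_const hc.measure_lt_top.ne)
    · refine Filter.Eventually.of_forall fun t τ hτ => ?_
      by_cases ht : t ∈ tsupport θ
      · exact (hder t (hS ht) τ ⟨by linarith [hτ.1], by linarith [hτ.2]⟩).const_smul (θ t)
      · simpa [hzero t ht] using hasDerivAt_const τ (0 : ℂ)
  refine norm_image_sub_le_of_norm_deriv_le_segment_01' (f := fun σ => ∫ t, θ t • G σ t)
    (fun σ hσ => (hint σ hσ).hasDerivWithinAt) fun σ hσ' => ?_
  have hσ : σ ∈ Icc (0 : ℝ) 1 := Ico_subset_Icc_self hσ'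
  have hσI := hIcc σ hσ
  -- integration by parts
  set g : ι → EuclideanSpace ℝ ι → ℂ := fun k t =>
    F (γ t + σ • η t) * D (Function.update (homCol γ η σ t) k (η t)) with hg
  have hdiv := fun t (ht : t ∈ W) => divergence_identity hD (σ := σ)
    (hγ.contDiffAt (hW.mem_nhds ht)) (hη.contDiffAt (hW.mem_nhds ht))
    ((hF.contDiffAt (hT.mem_nhds (hmem σ hσI t ht))).differentiableAt (by norm_num))
  have cg : ∀ k, ContinuousOn (g k) W := fun k => slice (cFγ.mul (cDu k cη)) σ hσI
  have cAnti : ∀ {v : EuclideanSpace ℝ ι → E}, ContinuousOn v W →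
      ContinuousOn (fun t => antiPart (fderiv ℝ F (γ t + σ • η t)) (v t)) W := by
    intro v hv
    have h0 : ContinuousOn (fun t => fderiv ℝ F (γ t + σ • η t)) W :=
      cdF.comp (f := fun t => (σ, t)) (by fun_prop) fun t ht => ⟨hσI, ht⟩
    exact ((h0.clm_apply hv).add (continuousOn_const.mul
      (h0.clm_apply (hv.const_smul Complex.I)))).div_const 2
  have chc' : ContinuousOn (homCol γ η σ) W :=
    chc.comp (f := fun t => (σ, t)) (by fun_prop) fun t ht => ⟨hσI, ht⟩
  have cerr : ContinuousOn (stokesErr D F γ η σ) W :=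
    ((cAnti hη.continuousOn).mul (D.cont.comp_continuousOn chc')).sub
      (continuousOn_finsetSum _ fun k _ => (cAnti (continuousOn_pi.1 chc' k)).mul
        (slice (cDu k cη) σ hσI))
  have hθk : ∀ k, tsupport (fun t => fderiv ℝ θ t (dir k)) ⊆ tsupport θ := fun k =>
    tsupport_fderiv_apply_subset ℝ (dir k)
  have cθk : ∀ k, Continuous (fun t => fderiv ℝ θ t (dir k)) := fun k =>
    (hθ.continuous_fderiv (by norm_num)).clm_apply continuous_const
  have i1 : ∀ k, Integrable fun t => fderiv ℝ θ t (dir k) • g k t := fun k =>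
    integrable_smul_of_tsupport_subset hW (cθk k) (hc.mono' ((subset_tsupport _).trans (hθk k)))
      ((hθk k).trans hS) (cg k)
  have i2 : Integrable fun t => θ t • stokesErr D F γ η σ t :=
    integrable_smul_of_tsupport_subset hW hθ.continuous hc hS cerr
  have dg : ∀ k, ContDiffOn ℝ 1 (g k) W := by
    intro k
    have h1 : ContDiffOn ℝ 1 (fun t => F (γ t + σ • η t)) W :=
      hF.comp ((hγ.of_le (by norm_num)).add ((hη.of_le (by norm_num)).const_smul σ))
        fun t ht => hmem σ hσI t ht
    have h2 : ContDiffOn ℝ 1 (fun t => Function.update (homCol γ η σ t) k (η t)) W := by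
      refine contDiffOn_pi.2 fun i => ?_
      by_cases hi : i = k
      · subst hi; simpa using hη.of_le (by norm_num)
      · simp only [Function.update_of_ne hi]
        exact ((hγ.fderiv_of_isOpen hW (m := 1) (by norm_num)).clm_apply contDiffOn_const).add
          (((hη.fderiv_of_isOpen hW (m := 1) (by norm_num)).clm_apply
            contDiffOn_const).const_smul σ)
    exact h1.mul (D.toContinuousMultilinearMap.contDiff.comp_contDiffOn h2)
  have i3 : ∀ k, Integrable fun t => θ t • fderiv ℝ (g k) t (dir k) := fun k =>
    integrable_smul_of_tsupport_subset hW hθ.continuous hc hS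
      (((dg k).continuousOn_fderiv_of_isOpen hW (by norm_num)).clm_apply continuousOn_const)
  have parts : ∀ k, ∫ t, θ t • fderiv ℝ (g k) t (dir k) =
      - ∫ t, fderiv ℝ θ t (dir k) • g k t := fun k =>
    integral_smul_fderiv_eq_neg_fderiv_smul_of_integrable (i1 k) (i3 k)
      (integrable_smul_of_tsupport_subset hW hθ.continuous hc hS (cg k))
      (fun t _ => hθ.differentiable (by norm_num) t)
      (fun t ht => ((dg k).contDiffAt (hW.mem_nhds (hS ht))).differentiableAt (by norm_num))
  have split : ∀ t, θ t • G' σ t =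
      ∑ k, θ t • fderiv ℝ (g k) t (dir k) + θ t • stokesErr D F γ η σ t := by
    intro t
    by_cases ht : t ∈ tsupport θ
    · rw [← Finset.smul_sum, ← smul_add]
      exact congrArg (fun z : ℂ => θ t • z) (hdiv t (hS ht)).2
    · simp [hzero t ht]
  have total : ∫ t, θ t • G' σ t =
      ∫ t, (θ t • stokesErr D F γ η σ t - ∑ k, fderiv ℝ θ t (dir k) • g k t) := by
    simp only [split]
    rw [integral_add (integrable_finsetSum _ fun k _ => i3 k) i2,
      integral_sub i2 (integrable_finsetSum _ fun k _ => i1 k),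
      integral_finsetSum _ fun k _ => i3 k, integral_finsetSum _ fun k _ => i1 k]
    simp only [parts, Finset.sum_neg_distrib]
    ring
  rw [total, ← setIntegral_eq_integral_of_forall_compl_eq_zero (s := tsupport θ)]
  · exact norm_setIntegral_le_of_norm_le_const hc.measure_lt_top (hQ σ hσ)
  · intro t ht
    have : ∀ k, fderiv ℝ θ t (dir k) = 0 := fun k =>
      image_eq_zero_of_notMem_tsupport (f := fun t => fderiv ℝ θ t (dir k))
        fun h => ht (hθk k h)
    simp [hzero t ht, this]

end StokesIntegral

/-! ### Conjugation on `ℂⁿ` and the anti-diagonal. -/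

section Conjugation

variable {n : ℕ}

@[simp] theorem conjVec_apply (x : Cn n) (j : Fin n) : conjVec x j = (starRingEnd ℂ) (x j) := rfl

/-- Complex conjugation as a real-linear isometry. -/
def conjL (n : ℕ) : Cn n →ₗᵢ[ℝ] Cn n where
  toFun := conjVec
  map_add' x y := by ext j; simp
  map_smul' c x := by ext j; simp
  norm_map' x := by
    simp only [LinearMap.coe_mk, AddHom.coe_mk]
    rw [EuclideanSpace.norm_eq, EuclideanSpace.norm_eq]
    simp

@[simp] theorem conjVec_conjVec (x : Cn n) : conjVec (conjVec x) = x := by ext j; simp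

theorem conjVec_add (x y : Cn n) : conjVec (x + y) = conjVec x + conjVec y := (conjL n).map_add x y

theorem conjVec_sub (x y : Cn n) : conjVec (x - y) = conjVec x - conjVec y := (conjL n).map_sub x y

theorem conjVec_smul (c : ℝ) (x : Cn n) : conjVec (c • x) = c • conjVec x := (conjL n).map_smul c x

theorem conjVec_I_smul (x : Cn n) : conjVec (Complex.I • x) = -(Complex.I • conjVec x) := by
  ext j; simp

@[simp] theorem norm_conjVec (x : Cn n) : ‖conjVec x‖ = ‖x‖ := (conjL n).norm_map x

theorem continuous_conjVec : Continuous (conjVec : Cn n → Cn n) := (conjL n).continuous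

/-- The inclusion `x ↦ (x, x̄)` of the anti-diagonal. -/
def antidiag (n : ℕ) : Cn n →L[ℝ] Cn n × Cn n :=
  (ContinuousLinearMap.id ℝ (Cn n)).prod (conjL n).toContinuousLinearMap

@[simp] theorem antidiag_apply (x : Cn n) : antidiag n x = (x, conjVec x) := rfl

end Conjugation

/-! ### The tube around the anti-diagonal. -/

section Tube

variable {n : ℕ}

/-- The parameters `x` and `z` of a point of the tube are unique: they are half the sum and half the
difference of its first component and the conjugate of the second. This form makes openness visible.
-/
theorem mem_tube_iff {U : Set (Cn n)} {ρ : ℝ} {p : Cn n × Cn n} :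
    p ∈ tube U ρ ↔ (1 / 2 : ℝ) • (p.1 + conjVec p.2) ∈ U ∧
      ‖(1 / 2 : ℝ) • (p.1 - conjVec p.2)‖ < ρ := by
  constructor
  · rintro ⟨x, hx, z, hz, rfl⟩
    have h1 : (1 / 2 : ℝ) • (x + z + conjVec (conjVec x - conjVec z)) = x := by
      rw [conjVec_sub, conjVec_conjVec, conjVec_conjVec]; module
    have h2 : (1 / 2 : ℝ) • (x + z - conjVec (conjVec x - conjVec z)) = z := by
      rw [conjVec_sub, conjVec_conjVec, conjVec_conjVec]; module
    simp only [h1, h2]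
    exact ⟨hx, hz⟩
  · rintro ⟨h1, h2⟩
    refine ⟨_, h1, _, h2, ?_⟩
    ext1
    · simp only []; module
    · simp only [conjVec_smul, conjVec_add, conjVec_sub, conjVec_conjVec]; module

theorem isOpen_tube {U : Set (Cn n)} (hU : IsOpen U) (ρ : ℝ) : IsOpen (tube U ρ) := by
  have : tube U ρ = (fun p : Cn n × Cn n => (1 / 2 : ℝ) • (p.1 + conjVec p.2)) ⁻¹' U ∩
      {p | ‖(1 / 2 : ℝ) • (p.1 - conjVec p.2)‖ < ρ} := by
    ext p; exact mem_tube_iff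
  rw [this]
  have hc := continuous_conjVec (n := n)
  exact (hU.preimage (by fun_prop)).inter (isOpen_lt (by fun_prop) continuous_const)

theorem mem_tube_of_norm_lt {U : Set (Cn n)} {ρ ε : ℝ} {y : Cn n} (hy : Metric.ball y ε ⊆ U)
    (hε : ε ≤ ρ) {p : Cn n × Cn n} (hp : ‖p - (y, conjVec y)‖ < ε) : p ∈ tube U ρ := by
  have h1 : ‖p.1 - y‖ < ε := (norm_fst_le (p - (y, conjVec y))).trans_lt hp
  have h2 : ‖conjVec p.2 - y‖ < ε := by
    have := (norm_snd_le (p - (y, conjVec y))).trans_lt hp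
    rw [← norm_conjVec] at this
    simpa [conjVec_sub] using this
  rw [mem_tube_iff]
  constructor
  · apply hy
    rw [mem_ball_iff_norm]
    have : (1 / 2 : ℝ) • (p.1 + conjVec p.2) - y =
      (1 / 2 : ℝ) • (p.1 - y) + (1 / 2 : ℝ) • (conjVec p.2 - y) := by module
    rw [this]
    refine (norm_add_le _ _).trans_lt ?_
    rw [norm_smul, norm_smul]; norm_num; linarith
  · refine lt_of_lt_of_le ?_ hε
    have : (1 / 2 : ℝ) • (p.1 - conjVec p.2) =
      (1 / 2 : ℝ) • (p.1 - y) - (1 / 2 : ℝ) • (conjVec p.2 - y) := by module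
    rw [this]
    refine (norm_sub_le _ _).trans_lt ?_
    rw [norm_smul, norm_smul]; norm_num; linarith

end Tube

/-! ### The Gevrey-flat weight. -/

section FlatWeight

theorem flatWeight_nonneg {s C t : ℝ} (hC : 0 < C) : 0 ≤ flatWeight s C t := by
  unfold flatWeight; split_ifs <;> positivity

@[simp] theorem flatWeight_zero {s C : ℝ} : flatWeight s C 0 = 0 := by simp [flatWeight]

theorem flatWeight_mono {s C t t' : ℝ} (hs : 1 < s) (hC : 0 < C) (ht : 0 ≤ t) (htt' : t ≤ t') :
    flatWeight s C t ≤ flatWeight s C t' := by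
  rcases ht.eq_or_lt with rfl | h
  · simpa using flatWeight_nonneg hC
  · have h' : 0 < t' := h.trans_le htt'
    rw [flatWeight, flatWeight, if_neg h.ne', if_neg h'.ne']
    have : t' ^ (-(1 / (s - 1))) ≤ t ^ (-(1 / (s - 1))) := by
      apply Real.rpow_le_rpow_of_nonpos h htt'
      have : 0 < 1 / (s - 1) := by apply one_div_pos.2; linarith
      linarith
    gcongr

theorem flatWeight_le_of_le {s C C' t : ℝ} (hC : 0 < C) (hCC' : C ≤ C') (ht : 0 ≤ t) :
    flatWeight s C t ≤ flatWeight s C' t := by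
  unfold flatWeight
  split_ifs
  · exact le_rfl
  · have : C'⁻¹ ≤ C⁻¹ := by gcongr
    have h2 : 0 ≤ t ^ (-(1 / (s - 1))) := by positivity
    have h3 : 0 ≤ C' := hC.le.trans hCC'
    gcongr

/-- Second-order vanishing is all of the flatness that is needed to make the Hessian on the
anti-diagonal complex bilinear. -/
theorem exists_flatWeight_le_sq {s C : ℝ} (hs : 1 < s) (hC : 0 < C) :
    ∃ M > 0, ∀ t, 0 ≤ t → flatWeight s C t ≤ M * t ^ 2 := by
  have hs' : 0 < 1 / (s - 1) := by apply one_div_pos.2; linarith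
  obtain ⟨M, hM, h⟩ := exists_inv_pow_mul_exp_le (β := 1 / (s - 1)) (c := C⁻¹ / 2) hs'
    (by positivity) 2
  refine ⟨C * M, by positivity, fun t ht => ?_⟩
  rcases ht.eq_or_lt with rfl | ht
  · simp
  · rw [flatWeight, if_neg ht.ne', mul_assoc]
    gcongr
    have h1 := h t ht
    have h2 : Real.exp (-(C⁻¹ / 2 * t ^ (-(1 / (s - 1))))) ≤ 1 := by
      rw [Real.exp_le_one_iff, neg_nonpos]; positivity
    have h3 : t⁻¹ ^ 2 * Real.exp (-(C⁻¹ * t ^ (-(1 / (s - 1))))) ≤ M := by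
      calc _ = t⁻¹ ^ 2 * Real.exp (-(2 * (C⁻¹ / 2) * t ^ (-(1 / (s - 1))))) := by congr 3; ring
        _ ≤ _ := h1
        _ ≤ M * 1 := by gcongr
        _ = M := mul_one M
    rw [inv_pow, inv_mul_le_iff₀ (by positivity)] at h3
    linarith

end FlatWeight

/-! ### Antilinear parts of derivatives in terms of `∂̄`. -/

section AntiPart

variable {E : Type*} [NormedAddCommGroup E] [NormedSpace ℝ E]
  [NormedSpace ℂ E] [IsScalarTower ℝ ℂ E]

theorem antiPart_add_left (L M : E →L[ℝ] ℂ) (v : E) :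
    antiPart (L + M) v = antiPart L v + antiPart M v := by
  simp only [antiPart, add_apply]; ring

theorem antiPart_sub_left (L M : E →L[ℝ] ℂ) (v : E) :
    antiPart (L - M) v = antiPart L v - antiPart M v := by
  simp only [antiPart, sub_apply]; ring

theorem antiPart_smul_left (z : ℂ) (L : E →L[ℝ] ℂ) (v : E) :
    antiPart (z • L) v = z * antiPart L v := by
  simp only [antiPart, smul_apply, smul_eq_mul]; ring

variable {n : ℕ}

theorem vec_eq_sum (ζ : Cn n × Cn n) :
    ζ = ∑ j, ζ.1 j • ((reIm n (Sum.inl j), 0) : Cn n × Cn n) +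
      ∑ j, ζ.2 j • ((0, reIm n (Sum.inl j)) : Cn n × Cn n) := by
  have h : ∀ x : Cn n, x = ∑ j, x j • reIm n (Sum.inl j) := by
    intro x
    ext i
    simp [reIm, Pi.single_apply]
  ext1
  · simpa [Prod.fst_sum] using h ζ.1
  · simpa [Prod.snd_sum] using h ζ.2

theorem I_smul_reIm (j : Fin n) :
    Complex.I • reIm n (Sum.inl j) = reIm n (Sum.inr j) := by
  ext i
  simp [reIm]

theorem antiPart_fst_eq_dbar (f : Cn n × Cn n → ℂ) (p : Cn n × Cn n) (j : Fin n) :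
    antiPart (fderiv ℝ f p) (reIm n (Sum.inl j), 0) =
      dbar (reIm n (Sum.inl j), (0 : Cn n)) (reIm n (Sum.inr j), 0) f p := by
  rw [antiPart, dbar, Prod.smul_mk, I_smul_reIm, smul_zero]

theorem antiPart_snd_eq_dbar (f : Cn n × Cn n → ℂ) (p : Cn n × Cn n) (j : Fin n) :
    antiPart (fderiv ℝ f p) (0, reIm n (Sum.inl j)) =
      dbar ((0 : Cn n), reIm n (Sum.inl j)) (0, reIm n (Sum.inr j)) f p := by
  rw [antiPart, dbar, Prod.smul_mk, I_smul_reIm, smul_zero]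

/-- The antilinear part is conjugate-linear in `ζ`, so it is determined by the `2n` coordinate
`∂̄`-derivatives; hence the factor `2n`. -/
theorem DbarFlat.norm_antiPart_le {s C : ℝ} {f : Cn n × Cn n → ℂ} {T : Set (Cn n × Cn n)}
    (hf : DbarFlat s C f T) (hC : 0 < C) {p : Cn n × Cn n} (hp : p ∈ T) (ζ : Cn n × Cn n) :
    ‖antiPart (fderiv ℝ f p) ζ‖ ≤
      2 * n * flatWeight s C ‖p.1 - conjVec p.2‖ * ‖ζ‖ := by
  have h0 := flatWeight_nonneg (s := s) (t := ‖p.1 - conjVec p.2‖) hC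
  have hn1 : ∀ j, ‖ζ.1 j‖ ≤ ‖ζ‖ := fun j => (PiLp.norm_apply_le ζ.1 j).trans (norm_fst_le ζ)
  have hn2 : ∀ j, ‖ζ.2 j‖ ≤ ‖ζ‖ := fun j => (PiLp.norm_apply_le ζ.2 j).trans (norm_snd_le ζ)
  conv_lhs => rw [vec_eq_sum ζ]
  rw [antiPart_add, antiPart_sum, antiPart_sum]
  simp only [antiPart_smul, antiPart_fst_eq_dbar, antiPart_snd_eq_dbar]
  refine (norm_add_le _ _).trans ?_
  have h1 : ‖∑ j, (starRingEnd ℂ) (ζ.1 j) *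
      dbar (reIm n (Sum.inl j), (0 : Cn n)) (reIm n (Sum.inr j), 0) f p‖ ≤
      ∑ _j : Fin n, ‖ζ‖ * flatWeight s C ‖p.1 - conjVec p.2‖ := by
    refine norm_sum_le_of_le _ fun j _ => ?_
    rw [norm_mul, RCLike.norm_conj]
    exact mul_le_mul (hn1 j) (hf p hp j).1 (norm_nonneg _) (norm_nonneg _)
  have h2 : ‖∑ j, (starRingEnd ℂ) (ζ.2 j) *
      dbar ((0 : Cn n), reIm n (Sum.inl j)) (0, reIm n (Sum.inr j)) f p‖ ≤
      ∑ _j : Fin n, ‖ζ‖ * flatWeight s C ‖p.1 - conjVec p.2‖ := by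
    refine norm_sum_le_of_le _ fun j _ => ?_
    rw [norm_mul, RCLike.norm_conj]
    exact mul_le_mul (hn2 j) (hf p hp j).2 (norm_nonneg _) (norm_nonneg _)
  simp only [Finset.sum_const, Finset.card_univ, Fintype.card_fin, nsmul_eq_mul] at h1 h2
  linarith

end AntiPart

/-! ### Taylor expansion of mixed second differences. -/

section MixedTaylor

variable {E₁ E₂ G : Type*} [NormedAddCommGroup E₁] [NormedSpace ℝ E₁] [NormedAddCommGroup E₂]
  [NormedSpace ℝ E₂] [NormedAddCommGroup G] [NormedSpace ℝ G]

/-- A mixed second difference is close to the mixed second derivative. -/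
theorem norm_mixed_difference_sub_le {f : E₁ × E₂ → G} {A : Set E₁} {B : Set E₂}
    (hA : Convex ℝ A) (hB : Convex ℝ B)
    (hd : ∀ p ∈ A ×ˢ B, DifferentiableAt ℝ f p)
    (hdd : ∀ p ∈ A ×ˢ B, DifferentiableAt ℝ (fderiv ℝ f) p)
    {H : E₁ × E₂ →L[ℝ] E₁ × E₂ →L[ℝ] G} {ε : ℝ}
    (hε : ∀ p ∈ A ×ˢ B, ‖fderiv ℝ (fderiv ℝ f) p - H‖ ≤ ε)
    {x x' : E₁} {y y' : E₂} (hx : x ∈ A) (hx' : x' ∈ A) (hy : y ∈ B) (hy' : y' ∈ B) :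
    ‖f (x', y') - f (x', y) - f (x, y') + f (x, y) - H (x' - x, 0) (0, y' - y)‖ ≤
      ε * ‖x' - x‖ * ‖y' - y‖ := by
  have step : ∀ b ∈ B, ‖fderiv ℝ f (x', b) - fderiv ℝ f (x, b) - H (x' - x, 0)‖ ≤
      ε * ‖x' - x‖ := by
    intro b hb
    have := Convex.norm_image_sub_le_of_norm_hasFDerivWithin_le'
      (f := fun a => fderiv ℝ f (a, b)) (s := A) (C := ε)
      (f' := fun a => (fderiv ℝ (fderiv ℝ f) (a, b)).comp (ContinuousLinearMap.inl ℝ E₁ E₂))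
      (φ := H.comp (ContinuousLinearMap.inl ℝ E₁ E₂)) (x := x) (y := x')
      (fun a ha => ((hdd (a, b) ⟨ha, hb⟩).hasFDerivAt.comp a
        (hasFDerivAt_prodMk_left a b)).hasFDerivWithinAt)
      (fun a ha => by
        rw [← ContinuousLinearMap.sub_comp]
        refine (ContinuousLinearMap.opNorm_comp_le _ _).trans ?_
        have h1 := hε (a, b) ⟨ha, hb⟩
        have h2 := ContinuousLinearMap.norm_inl_le_one ℝ E₁ E₂
        nlinarith [norm_nonneg (fderiv ℝ (fderiv ℝ f) (a, b) - H),
          norm_nonneg (ContinuousLinearMap.inl ℝ E₁ E₂)]) hA hx hx'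
    simpa using this
  have := Convex.norm_image_sub_le_of_norm_hasFDerivWithin_le'
    (f := fun b => f (x', b) - f (x, b)) (s := B) (C := ε * ‖x' - x‖)
    (f' := fun b => (fderiv ℝ f (x', b) - fderiv ℝ f (x, b)).comp
      (ContinuousLinearMap.inr ℝ E₁ E₂))
    (φ := (H (x' - x, 0)).comp (ContinuousLinearMap.inr ℝ E₁ E₂)) (x := y) (y := y')
    (fun b hb => by
      rw [ContinuousLinearMap.sub_comp]
      exact (((hd (x', b) ⟨hx', hb⟩).hasFDerivAt.comp b (hasFDerivAt_prodMk_right x' b)).sub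
        ((hd (x, b) ⟨hx, hb⟩).hasFDerivAt.comp b
          (hasFDerivAt_prodMk_right x b))).hasFDerivWithinAt)
    (fun b hb => by
      rw [← ContinuousLinearMap.sub_comp]
      refine (ContinuousLinearMap.opNorm_comp_le _ _).trans ?_
      have h1 := step b hb
      have h2 := ContinuousLinearMap.norm_inr_le_one ℝ E₁ E₂
      nlinarith [norm_nonneg (fderiv ℝ f (x', b) - fderiv ℝ f (x, b) - H (x' - x, 0)),
        norm_nonneg (ContinuousLinearMap.inr ℝ E₁ E₂)]) hB hy hy'
  convert this using 2
  simp; abel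

/-- The Hessian is taken at the moving base point `(x, y)`, while `R` depends on `p₀` only. Half of
`ε` is used to pass from a nearby point to `p₀`, the other half from `p₀` to `(x, y)`. -/
theorem exists_norm_mixed_difference_sub_le {f : E₁ × E₂ → G} {p₀ : E₁ × E₂}
    (hf : ContDiffAt ℝ 2 f p₀) {ε : ℝ} (hε : 0 < ε) :
    ∃ R > 0, ∀ x x' : E₁, ∀ y y' : E₂, dist x p₀.1 < R → dist x' p₀.1 < R → dist y p₀.2 < R →
      dist y' p₀.2 < R →
      ‖f (x', y') - f (x', y) - f (x, y') + f (x, y) -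
        fderiv ℝ (fderiv ℝ f) (x, y) (x' - x, 0) (0, y' - y)‖ ≤ ε * ‖x' - x‖ * ‖y' - y‖ := by
  have hcont : ContinuousAt (fderiv ℝ (fderiv ℝ f)) p₀ :=
    ((hf.fderiv_right (m := 1) (by norm_num)).fderiv_right (m := 0) (by norm_num)).continuousAt
  have hnear : ∀ᶠ p in nhds p₀, ContDiffAt ℝ 2 f p ∧
      ‖fderiv ℝ (fderiv ℝ f) p - fderiv ℝ (fderiv ℝ f) p₀‖ < ε / 2 := by
    refine (hf.eventually (by simp)).and ?_
    have h0 : ContinuousAt (fun p => ‖fderiv ℝ (fderiv ℝ f) p - fderiv ℝ (fderiv ℝ f) p₀‖) p₀ :=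
      (hcont.sub continuousAt_const).norm
    exact h0.eventually_lt continuousAt_const (by simpa using hε)
  obtain ⟨R, hR, hball⟩ := Metric.eventually_nhds_iff_ball.1 hnear
  refine ⟨R, hR, fun x x' y y' hx hx' hy hy' => ?_⟩
  have hprod : Metric.ball p₀.1 R ×ˢ Metric.ball p₀.2 R = Metric.ball p₀ R :=
    ball_prod_same _ _ _
  refine norm_mixed_difference_sub_le (convex_ball p₀.1 R) (convex_ball p₀.2 R)
    (fun p hp => (hball p (hprod ▸ hp)).1.differentiableAt (by norm_num))
    (fun p hp => ((hball p (hprod ▸ hp)).1.fderiv_right (m := 1) (by norm_num)).differentiableAt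
      (by norm_num)) (fun p hp => ?_) hx hx' hy hy'
  have a1 := (hball p (hprod ▸ hp)).2
  have a2 := (hball (x, y) (hprod ▸ ⟨hx, hy⟩)).2
  rw [norm_sub_rev] at a2
  have a3 := norm_add_le (fderiv ℝ (fderiv ℝ f) p - fderiv ℝ (fderiv ℝ f) p₀)
    (fderiv ℝ (fderiv ℝ f) p₀ - fderiv ℝ (fderiv ℝ f) (x, y))
  rw [sub_add_sub_cancel] at a3
  linarith

end MixedTaylor

/-! ### The Hessian of the polarization and the Levi form. -/

section Hessian

open Filter Topology

variable {n : ℕ}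

/-- The Hessian of `Ψ` at the anti-diagonal point `(y, ȳ)`. -/
abbrev hess (Ψ : Cn n × Cn n → ℂ) (y : Cn n) : Cn n × Cn n →L[ℝ] Cn n × Cn n →L[ℝ] ℂ :=
  fderiv ℝ (fderiv ℝ Ψ) (y, conjVec y)

theorem hasFDerivAt_antiPart {f : Cn n × Cn n → ℂ} {p : Cn n × Cn n}
    (hf : DifferentiableAt ℝ (fderiv ℝ f) p) (η : Cn n × Cn n) :
    ∃ L : Cn n × Cn n →L[ℝ] ℂ, HasFDerivAt (fun q => antiPart (fderiv ℝ f q) η) L p ∧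
      ∀ ζ, L ζ = antiPart (fderiv ℝ (fderiv ℝ f) p ζ) η := by
  have h1 := hf.hasFDerivAt.clm_apply (hasFDerivAt_const η p)
  have h2 := hf.hasFDerivAt.clm_apply (hasFDerivAt_const (Complex.I • η) p)
  have h3 := (h1.add (h2.const_mul Complex.I)).mul_const ((2 : ℂ)⁻¹)
  refine ⟨_, h3.congr_of_eventuallyEq (Eventually.of_forall fun q => ?_), fun ζ => ?_⟩
  · simp [antiPart, div_eq_mul_inv]
  · simp [antiPart, div_eq_mul_inv, mul_comm, mul_add]

/-- The antilinear part of `DΨ` is `O(|q - (y, ȳ)|²)`, because `|x - conj ỹ|` is at most twice that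
distance and the flat weight vanishes quadratically. Its derivative at `(y, ȳ)` is therefore zero.
-/
theorem antiPart_hess_eq_zero {s C : ℝ} (hs : 1 < s) (hC : 0 < C) {Ψ : Cn n × Cn n → ℂ}
    {T : Set (Cn n × Cn n)} (hT : IsOpen T) (hΨ : ContDiffOn ℝ ∞ Ψ T) (hf : DbarFlat s C Ψ T)
    {y : Cn n} (hy : (y, conjVec y) ∈ T) (ζ η : Cn n × Cn n) : antiPart (hess Ψ y ζ) η = 0 := by
  have hd : DifferentiableAt ℝ (fderiv ℝ Ψ) (y, conjVec y) :=
    ((hΨ.contDiffAt (hT.mem_nhds hy)).fderiv_right (m := 1) (by norm_cast)).differentiableAt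
      (by norm_num)
  obtain ⟨L, hL, hL'⟩ := hasFDerivAt_antiPart hd η
  obtain ⟨M, hM, hflat⟩ := exists_flatWeight_le_sq hs hC
  have hO : (fun q => antiPart (fderiv ℝ Ψ q) η) =O[𝓝 (y, conjVec y)]
      fun q => ‖q - (y, conjVec y)‖ ^ 2 := by
    refine Asymptotics.IsBigO.of_bound (2 * n * (M * 4) * ‖η‖) ?_
    filter_upwards [hT.mem_nhds hy] with q hq
    refine (hf.norm_antiPart_le hC hq η).trans ?_
    have h1 : ‖q.1 - conjVec q.2‖ ≤ 2 * ‖q - (y, conjVec y)‖ := by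
      have e : q.1 - conjVec q.2 = (q.1 - y) - conjVec (q.2 - conjVec y) := by
        rw [conjVec_sub, conjVec_conjVec]; abel
      rw [e]
      refine (norm_sub_le _ _).trans ?_
      rw [norm_conjVec]
      have a1 := norm_fst_le (q - (y, conjVec y))
      have a2 := norm_snd_le (q - (y, conjVec y))
      simp only [Prod.fst_sub, Prod.snd_sub] at a1 a2
      linarith
    have h2 : flatWeight s C ‖q.1 - conjVec q.2‖ ≤ M * 4 * ‖q - (y, conjVec y)‖ ^ 2 := by
      refine (hflat _ (norm_nonneg _)).trans ?_
      calc M * ‖q.1 - conjVec q.2‖ ^ 2 ≤ M * (2 * ‖q - (y, conjVec y)‖) ^ 2 := by gcongr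
        _ = _ := by ring
    rw [Real.norm_of_nonneg (by positivity : 0 ≤ ‖q - (y, conjVec y)‖ ^ 2)]
    calc 2 * n * flatWeight s C ‖q.1 - conjVec q.2‖ * ‖η‖
        ≤ 2 * n * (M * 4 * ‖q - (y, conjVec y)‖ ^ 2) * ‖η‖ := by gcongr
      _ = _ := by ring
  have h0 : HasFDerivAt (fun q => antiPart (fderiv ℝ Ψ q) η) 0 (y, conjVec y) :=
    Asymptotics.IsBigO.hasFDerivAt (𝕜 := ℝ) hO (by norm_num)
  rw [← hL' ζ, hL.unique h0]
  rfl

theorem apply_I_smul_of_antiPart_eq_zero {E : Type*} [NormedAddCommGroup E] [NormedSpace ℝ E]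
    [NormedSpace ℂ E] {L : E →L[ℝ] ℂ} {v : E} (h : antiPart L v = 0) :
    L (Complex.I • v) = Complex.I * L v := by
  rw [antiPart, div_eq_zero_iff] at h
  have h1 := h.resolve_right (by norm_num)
  have hI := Complex.I_sq
  linear_combination (-Complex.I) * h1 + L (Complex.I • v) * hI

/-- The properties of the Hessian of a polarization at an anti-diagonal point. -/
structure IsPolarHessian (H : Cn n × Cn n →L[ℝ] Cn n × Cn n →L[ℝ] ℂ) : Prop where
  right : ∀ ζ η, H ζ (Complex.I • η) = Complex.I * H ζ η
  symm : ∀ ζ η, H ζ η = H η ζ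
  real : ∀ ζ η, (H (antidiag n ζ) (antidiag n η)).im = 0

theorem IsPolarHessian.left {H : Cn n × Cn n →L[ℝ] Cn n × Cn n →L[ℝ] ℂ} (hH : IsPolarHessian H)
    (ζ η : Cn n × Cn n) : H (Complex.I • ζ) η = Complex.I * H ζ η := by
  rw [hH.symm, hH.right, hH.symm]

/-- Reality comes from differentiating `Im Ψ(x, x̄) = 0` twice. As `antidiag` is linear, no
first-order term of `Ψ` enters. -/
theorem isPolarHessian_hess {s ρ : ℝ} (hs : 1 < s) {Φ : Cn n → ℝ} {U : Set (Cn n)}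
    (hU : IsOpen U) {Ψ : Cn n × Cn n → ℂ} (hΨ : IsPolarization s Φ U ρ Ψ) {y : Cn n}
    (hyU : y ∈ U) (hy : (y, conjVec y) ∈ tube U ρ) : IsPolarHessian (hess Ψ y) := by
  obtain ⟨C, hC, hf⟩ := hΨ.flat
  have hT := isOpen_tube hU ρ
  have hcd := hΨ.gevrey.1.contDiffAt (hT.mem_nhds hy)
  refine ⟨fun ζ η => apply_I_smul_of_antiPart_eq_zero
    (antiPart_hess_eq_zero hs hC hT hΨ.gevrey.1 hf hy ζ η), fun ζ η => ?_, fun ζ η => ?_⟩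
  · exact (hcd.isSymmSndFDerivAt (by simpa using (by norm_cast : (2 : WithTop ℕ∞) ≤ ∞))) ζ η
  · have hmem : ∀ᶠ x in 𝓝 y, x ∈ U ∧ (x, conjVec x) ∈ tube U ρ :=
      Filter.Eventually.and (hU.mem_nhds hyU) ((antidiag n).continuous.continuousAt.preimage_mem_nhds
        (hT.mem_nhds hy))
    have hz : ∀ᶠ x in 𝓝 y, (fderiv ℝ Ψ (antidiag n x) (antidiag n η)).im = 0 := by
      filter_upwards [hmem.eventually_nhds] with x hx
      have h1 : HasFDerivAt (fun x => (Ψ (antidiag n x)).im)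
          (Complex.imCLM.comp ((fderiv ℝ Ψ (antidiag n x)).comp (antidiag n))) x := by
        refine Complex.imCLM.hasFDerivAt.comp x (HasFDerivAt.comp x ?_ (antidiag n).hasFDerivAt)
        exact ((hΨ.gevrey.1.contDiffAt (hT.mem_nhds hx.self_of_nhds.2)).differentiableAt
          (by simp)).hasFDerivAt
      have h2 : HasFDerivAt (fun x => (Ψ (antidiag n x)).im) (0 : Cn n →L[ℝ] ℝ) x := by
        refine (hasFDerivAt_const (0 : ℝ) x).congr_of_eventuallyEq ?_
        filter_upwards [hx] with x' hx'
        simp [hΨ.diag x' hx'.1]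
      have := congrArg (fun A : Cn n →L[ℝ] ℝ => A η) (h1.unique h2)
      simpa using this
    have hd : DifferentiableAt ℝ (fderiv ℝ Ψ) (antidiag n y) :=
      (hcd.fderiv_right (m := 1) (by norm_cast)).differentiableAt (by norm_num)
    have h1 : HasFDerivAt (fun x => (fderiv ℝ Ψ (antidiag n x) (antidiag n η)).im)
        (Complex.imCLM.comp (((hess Ψ y).flip (antidiag n η)).comp (antidiag n))) y := by
      refine Complex.imCLM.hasFDerivAt.comp y ?_
      have := (hd.hasFDerivAt.comp y (antidiag n).hasFDerivAt).clm_apply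
        (hasFDerivAt_const (antidiag n η) y)
      refine this.congr_fderiv ?_
      ext v; simp
    have h2 : HasFDerivAt (fun x => (fderiv ℝ Ψ (antidiag n x) (antidiag n η)).im)
        (0 : Cn n →L[ℝ] ℝ) y :=
      (hasFDerivAt_const (0 : ℝ) y).congr_of_eventuallyEq hz
    have := congrArg (fun A : Cn n →L[ℝ] ℝ => A ζ) (h1.unique h2)
    simpa using this

/-- By bilinearity over `ℂ`, the mixed block is recovered from the values on anti-diagonal vectors,
where `H` is real. This gives both the symmetry in `re_comm` and the identification with the Levi
form. -/
theorem IsPolarHessian.four_mul_eq {H : Cn n × Cn n →L[ℝ] Cn n × Cn n →L[ℝ] ℂ}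
    (hH : IsPolarHessian H) (z w : Cn n) :
    4 * H (z, 0) (0, conjVec w) =
      H (antidiag n z) (antidiag n w) +
        H (antidiag n (Complex.I • z)) (antidiag n (Complex.I • w)) +
        Complex.I * (H (antidiag n z) (antidiag n (Complex.I • w)) -
          H (antidiag n (Complex.I • z)) (antidiag n w)) := by
  have e1 : ∀ z : Cn n, antidiag n z = (z, 0) + (0, conjVec z) := fun z => by simp
  have e2 : ∀ z : Cn n, antidiag n (Complex.I • z) =
      Complex.I • ((z, 0) : Cn n × Cn n) - Complex.I • ((0, conjVec z) : Cn n × Cn n) := fun z => by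
    simp [conjVec_I_smul]
  have hI := Complex.I_sq
  rw [e2, e2, e1, e1]
  simp only [map_add, map_sub, add_apply, sub_apply, hH.right, hH.left]
  ring_nf
  rw [hI]
  ring

theorem IsPolarHessian.re_comm {H : Cn n × Cn n →L[ℝ] Cn n × Cn n →L[ℝ] ℂ}
    (hH : IsPolarHessian H) (z w : Cn n) :
    (H (z, 0) (0, conjVec w)).re = (H (w, 0) (0, conjVec z)).re := by
  have h1 := congrArg Complex.re (hH.four_mul_eq z w)
  have h2 := congrArg Complex.re (hH.four_mul_eq w z)
  have r := hH.real
  simp only [Complex.add_re, Complex.mul_re, Complex.I_re, Complex.I_im, Complex.sub_im, r] at h1 h2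
  rw [hH.symm (antidiag n w), hH.symm (antidiag n (Complex.I • w)) (antidiag n (Complex.I • z))]
    at h2
  norm_num at h1 h2
  linarith

/-- The cross terms `σ H(z, w̄)` and `-σ H(w, z̄)` have opposite real parts by `re_comm`. The result
depends on `σ` through `σ² L(w)` alone, which is why the contraction scales the anti-diagonal
component. -/
theorem IsPolarHessian.re_homotopy {H : Cn n × Cn n →L[ℝ] Cn n × Cn n →L[ℝ] ℂ}
    (hH : IsPolarHessian H) (z w : Cn n) (σ : ℝ) :
    (H (z + σ • w, 0) (0, conjVec (σ • w - z))).re =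
      σ ^ 2 * (H (w, 0) (0, conjVec w)).re - (H (z, 0) (0, conjVec z)).re := by
  have e1 : ((z + σ • w, 0) : Cn n × Cn n) = (z, 0) + σ • (w, 0) := by simp
  have e2 : ((0, conjVec (σ • w - z)) : Cn n × Cn n) =
      σ • (0, conjVec w) - (0, conjVec z) := by simp [conjVec_sub, conjVec_smul]
  rw [e1, e2]
  simp only [map_add, map_sub, map_smul, add_apply, smul_apply,
    Complex.add_re, Complex.sub_re, Complex.real_smul, Complex.re_ofReal_mul]
  rw [hH.re_comm z w]
  ring

theorem IsPolarHessian.smul_right {H : Cn n × Cn n →L[ℝ] Cn n × Cn n →L[ℝ] ℂ}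
    (hH : IsPolarHessian H) (c : ℂ) (ζ η : Cn n × Cn n) : H ζ (c • η) = c * H ζ η := by
  rw [complex_smul_eq, map_add, map_smul, map_smul, hH.right, Complex.real_smul, Complex.real_smul]
  conv_rhs => rw [← Complex.re_add_im c]
  ring

/-- Since `Φ = Ψ ∘ antidiag` near `y`, the Wirtinger derivatives of `Φ` are exactly the combination
in `four_mul_eq`. Complex bilinearity extends this from the coordinate vectors to all `ξ`. -/
theorem leviForm_eq_hess {s ρ : ℝ} {Φ : Cn n → ℝ} {U : Set (Cn n)}
    (hU : IsOpen U) {Ψ : Cn n × Cn n → ℂ} (hΨ : IsPolarization s Φ U ρ Ψ) {y : Cn n}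
    (hyU : y ∈ U) (hy : (y, conjVec y) ∈ tube U ρ) (hH : IsPolarHessian (hess Ψ y)) (ξ : Cn n) :
    leviForm Φ y ξ = hess Ψ y (ξ, 0) (0, conjVec ξ) := by
  have hT := isOpen_tube hU ρ
  have hcd := hΨ.gevrey.1.contDiffAt (hT.mem_nhds hy)
  have hd : DifferentiableAt ℝ (fderiv ℝ Ψ) (antidiag n y) :=
    (hcd.fderiv_right (m := 1) (by norm_cast)).differentiableAt (by norm_num)
  have hmem : ∀ᶠ x in 𝓝 y, x ∈ U ∧ (x, conjVec x) ∈ tube U ρ :=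
    Filter.Eventually.and (hU.mem_nhds hyU) ((antidiag n).continuous.continuousAt.preimage_mem_nhds
      (hT.mem_nhds hy))
  have hΦ' : ∀ᶠ x in 𝓝 y, fderiv ℝ (fun t => (Φ t : ℂ)) x =
      (fderiv ℝ Ψ (antidiag n x)).comp (antidiag n) := by
    filter_upwards [hmem.eventually_nhds] with x hx
    have h1 : HasFDerivAt (fun x => Ψ (antidiag n x))
        ((fderiv ℝ Ψ (antidiag n x)).comp (antidiag n)) x :=
      HasFDerivAt.comp x ((hΨ.gevrey.1.contDiffAt
        (hT.mem_nhds hx.self_of_nhds.2)).differentiableAt (by simp)).hasFDerivAt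
        (antidiag n).hasFDerivAt
    refine (h1.congr_of_eventuallyEq ?_).fderiv
    filter_upwards [hx] with x' hx'
    simp [hΨ.diag x' hx'.1]
  have hdb : ∀ v w : Cn n, ∃ L : Cn n →L[ℝ] ℂ,
      HasFDerivAt (dbar v w fun t => (Φ t : ℂ)) L y ∧ ∀ u, L u =
        (hess Ψ y (antidiag n u) (antidiag n v) +
          Complex.I * hess Ψ y (antidiag n u) (antidiag n w)) / 2 := by
    intro v w
    have h0 := hd.hasFDerivAt.comp y (antidiag n).hasFDerivAt
    have h1 := h0.clm_apply (hasFDerivAt_const (antidiag n v) y)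
    have h2 := h0.clm_apply (hasFDerivAt_const (antidiag n w) y)
    have h3 := (h1.add (h2.const_mul Complex.I)).mul_const ((2 : ℂ)⁻¹)
    refine ⟨_, h3.congr_of_eventuallyEq ?_, fun u => ?_⟩
    · filter_upwards [hΦ'] with x hx
      simp [dbar, hx, div_eq_mul_inv]
    · simp [div_eq_mul_inv, mul_comm, mul_add]
  have entry : ∀ j k : Fin n, del (reIm n (Sum.inl j)) (reIm n (Sum.inr j))
        (dbar (reIm n (Sum.inl k)) (reIm n (Sum.inr k)) (fun t => (Φ t : ℂ))) y =
      hess Ψ y (reIm n (Sum.inl j), 0) (0, conjVec (reIm n (Sum.inl k))) := by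
    intro j k
    obtain ⟨L, hL, hL'⟩ := hdb (reIm n (Sum.inl k)) (reIm n (Sum.inr k))
    rw [del, hL.fderiv, hL', hL']
    have h4 := hH.four_mul_eq (reIm n (Sum.inl j)) (reIm n (Sum.inl k))
    rw [I_smul_reIm, I_smul_reIm] at h4
    have hI := Complex.I_sq
    linear_combination (-1 / 4 : ℂ) * h4 + (-(1 / 4 : ℂ) *
      hess Ψ y (antidiag n (reIm n (Sum.inr j))) (antidiag n (reIm n (Sum.inr k)))) * hI
  have hconj : ∀ k : Fin n, conjVec (reIm n (Sum.inl k)) = reIm n (Sum.inl k) := by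
    intro k
    ext i
    simp only [conjVec_apply, reIm, Sum.elim_inl, PiLp.single_apply]
    split_ifs <;> simp
  have s1 : ((ξ, 0) : Cn n × Cn n) = ∑ j, ξ j • ((reIm n (Sum.inl j), 0) : Cn n × Cn n) := by
    simpa using vec_eq_sum ((ξ, 0) : Cn n × Cn n)
  have s2 : ((0, conjVec ξ) : Cn n × Cn n) =
      ∑ k, (starRingEnd ℂ) (ξ k) • ((0, reIm n (Sum.inl k)) : Cn n × Cn n) := by
    simpa using vec_eq_sum ((0, conjVec ξ) : Cn n × Cn n)
  rw [leviForm, s1, s2]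
  simp only [entry, hconj]
  rw [hH.symm, map_sum]
  refine Finset.sum_congr rfl fun j _ => ?_
  rw [hH.smul_right, hH.symm, map_sum, Finset.mul_sum]
  refine Finset.sum_congr rfl fun k _ => ?_
  rw [hH.smul_right]
  ring

/-- The phase decreases along the contraction of a contour onto the affine one. -/
theorem IsPolarHessian.re_homotopy_le {H : Cn n × Cn n →L[ℝ] Cn n × Cn n →L[ℝ] ℂ}
    (hH : IsPolarHessian H) (hpos : ∀ w : Cn n, 0 ≤ (H (w, 0) (0, conjVec w)).re) (z w : Cn n)
    {σ : ℝ} (h0 : 0 ≤ σ) (h1 : σ ≤ 1) :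
    (H (z + σ • w, 0) (0, conjVec (σ • w - z))).re ≤ (H (z + w, 0) (0, conjVec (w - z))).re := by
  have e := hH.re_homotopy z w 1
  simp only [one_smul, one_pow, one_mul] at e
  rw [hH.re_homotopy, e]
  have : σ ^ 2 ≤ 1 := pow_le_one₀ h0 h1
  nlinarith [hpos w]

end Hessian

/-! ### The phase along the contraction. -/

section Phase

open Filter Topology

variable {n : ℕ}

theorem sq_norm_le_add_sq (e : Cn n × Cn n) : ‖e‖ ^ 2 ≤ ‖e.1‖ ^ 2 + ‖e.2‖ ^ 2 := by
  rw [Prod.norm_def]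
  rcases max_choice ‖e.1‖ ‖e.2‖ with h | h <;> rw [h] <;>
    nlinarith [sq_nonneg ‖e.1‖, sq_nonneg ‖e.2‖]

/-- The point `(z + σ w, conj (σ w - z))` of the contraction onto the affine contour. -/
def contract (z w : Cn n) (σ : ℝ) : Cn n × Cn n := (z + σ • w, conjVec (σ • w - z))

/-- Up to conjugation, each component is a combination of `z + w` and `w - z` with coefficients `(1
± σ)/2` up to sign. The absolute values of these coefficients add up to `1`, so the sup norm does
not grow. -/
theorem norm_contract_le {z w : Cn n} {σ : ℝ} (h0 : 0 ≤ σ) (h1 : σ ≤ 1) :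
    ‖(contract z w σ).1‖ ≤ ‖contract z w 1‖ ∧ ‖(contract z w σ).2‖ ≤ ‖contract z w 1‖ := by
  have a1 : ‖z + w‖ ≤ ‖contract z w 1‖ := by simp [contract]
  have a2 : ‖w - z‖ ≤ ‖contract z w 1‖ := by simp [contract]
  have b1 : 0 ≤ (1 + σ) / 2 := by linarith
  have b2 : 0 ≤ (1 - σ) / 2 := by linarith
  constructor
  · have : (contract z w σ).1 = ((1 + σ) / 2) • (z + w) - ((1 - σ) / 2) • (w - z) := by
      simp only [contract]; module
    rw [this]
    refine (norm_sub_le _ _).trans ?_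
    rw [norm_smul, norm_smul, Real.norm_of_nonneg b1, Real.norm_of_nonneg b2]
    nlinarith
  · have : σ • w - z = ((1 + σ) / 2) • (w - z) - ((1 - σ) / 2) • (z + w) := by module
    simp only [contract, norm_conjVec]
    rw [this]
    refine (norm_sub_le _ _).trans ?_
    rw [norm_smul, norm_smul, Real.norm_of_nonneg b1, Real.norm_of_nonneg b2]
    simp only [contract] at a1 a2
    nlinarith

theorem antidiag_mem_tube {U : Set (Cn n)} {ρ : ℝ} (hρ : 0 < ρ) {y : Cn n} (hy : y ∈ U) :
    (y, conjVec y) ∈ tube U ρ :=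
  ⟨y, hy, 0, by simpa using hρ, by rw [add_zero, ← conjVec_sub, sub_zero]⟩

/-- A good phase stays good along the contraction onto the affine contour. -/
theorem exists_phase_contract_le {s ρ K : ℝ} (hs : 1 < s) (hρ : 0 < ρ) (hK : 0 < K)
    {Φ : Cn n → ℝ} {U : Set (Cn n)} (hU : IsOpen U) {Ψ : Cn n × Cn n → ℂ}
    (hΨ : IsPolarization s Φ U ρ Ψ) (hlevi : ∀ y ∈ U, ∀ ξ, 0 ≤ (leviForm Φ y ξ).re)
    {y₀ : Cn n} (hy₀ : y₀ ∈ U) :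
    ∃ ε > 0, ε ≤ ρ ∧ ∀ᶠ y in 𝓝 y₀, Metric.ball y ε ⊆ U ∧ ∀ z w : Cn n, ‖contract z w 1‖ < ε →
      (phase Ψ (y, conjVec y) ((y, conjVec y) + contract z w 1)).re ≤
        -(K⁻¹ * (‖(contract z w 1).1‖ ^ 2 + ‖(contract z w 1).2‖ ^ 2)) →
      ∀ σ, 0 ≤ σ → σ ≤ 1 →
        (phase Ψ (y, conjVec y) ((y, conjVec y) + contract z w σ)).re ≤
          -((2 * K)⁻¹ * ‖contract z w 1‖ ^ 2) := by
  have hT := isOpen_tube hU ρ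
  have hp₀ := antidiag_mem_tube hρ hy₀
  set p₀ : Cn n × Cn n := (y₀, conjVec y₀) with hp₀def
  have hcd := hΨ.gevrey.1
  have hK4 : 0 < (4 * K)⁻¹ := by positivity
  obtain ⟨R, hR, hball⟩ := exists_norm_mixed_difference_sub_le
    ((hcd.contDiffAt (hT.mem_nhds hp₀)).of_le (by norm_cast)) hK4
  obtain ⟨r, hr, hrU⟩ := Metric.isOpen_iff.1 hU y₀ hy₀
  refine ⟨min (min (R / 2) (r / 2)) ρ, by positivity, min_le_right _ _, ?_⟩
  set ε := min (min (R / 2) (r / 2)) ρ with hε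
  have e1 : ε ≤ R / 2 := (min_le_left _ _).trans (min_le_left _ _)
  have e2 : ε ≤ r / 2 := (min_le_left _ _).trans (min_le_right _ _)
  filter_upwards [Metric.ball_mem_nhds y₀ (half_pos hR), Metric.ball_mem_nhds y₀ (half_pos hr)]
    with y hyR hyr
  have hyU : y ∈ U := hrU (Metric.ball_subset_ball (by linarith) hyr)
  refine ⟨fun x hx => hrU ?_, ?_⟩
  · rw [Metric.mem_ball] at *
    linarith [dist_triangle x y y₀]
  intro z w he hgood σ h0 h1
  have hH : IsPolarHessian (hess Ψ y) :=
    isPolarHessian_hess hs hU hΨ hyU (antidiag_mem_tube hρ hyU)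
  have hpos : ∀ w : Cn n, 0 ≤ (hess Ψ y (w, 0) (0, conjVec w)).re := fun w => by
    rw [← leviForm_eq_hess hU hΨ hyU (antidiag_mem_tube hρ hyU) hH]
    exact hlevi y hyU w
  have hy1 : dist y y₀ < R / 2 := hyR
  have hy2 : dist (conjVec y) (conjVec y₀) < R / 2 := by
    rw [dist_eq_norm, ← conjVec_sub, norm_conjVec, ← dist_eq_norm]; exact hyR
  -- The phase is exactly a mixed second difference of `Ψ`. The expansion is used twice, at `σ = 1`
  -- and at `σ`, and each use loses `(4K)⁻¹`; this leaves `(2K)⁻¹` of the initial `K⁻¹`.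
  have hmixed : ∀ u v : Cn n, ‖u‖ < ε → ‖v‖ < ε →
      |(phase Ψ (y, conjVec y) ((y, conjVec y) + (u, v))).re - (hess Ψ y (u, 0) (0, v)).re| ≤
        (4 * K)⁻¹ * ‖u‖ * ‖v‖ := by
    intro u v hu hv
    have shift : ∀ {b b₀ u : Cn n}, dist b b₀ < R / 2 → ‖u‖ < ε → dist (b + u) b₀ < R := by
      intro b b₀ u hb hu
      have : dist (b + u) b = ‖u‖ := by rw [dist_eq_norm]; simp
      linarith [dist_triangle (b + u) b b₀]
    have := hball y (y + u) (conjVec y) (conjVec y + v) (by linarith) (shift hy1 hu)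
      (by linarith) (shift hy2 hv)
    simp only [add_sub_cancel_left] at this
    refine le_trans ?_ this
    rw [← Complex.sub_re]
    exact Complex.abs_re_le_norm _
  have hc := norm_contract_le (z := z) (w := w) h0 h1
  have hc1 := norm_contract_le (z := z) (w := w) (σ := 1) (by norm_num) le_rfl
  have m1 := hmixed (contract z w 1).1 (contract z w 1).2 (hc1.1.trans_lt he) (hc1.2.trans_lt he)
  have mσ := hmixed (contract z w σ).1 (contract z w σ).2 (hc.1.trans_lt he) (hc.2.trans_lt he)
  have hle := hH.re_homotopy_le hpos z w h0 h1
  have q1 : ‖(contract z w 1).1‖ * ‖(contract z w 1).2‖ ≤ ‖contract z w 1‖ ^ 2 := by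
    rw [sq]; exact mul_le_mul hc1.1 hc1.2 (norm_nonneg _) (norm_nonneg _)
  have qσ : ‖(contract z w σ).1‖ * ‖(contract z w σ).2‖ ≤ ‖contract z w 1‖ ^ 2 := by
    rw [sq]; exact mul_le_mul hc.1 hc.2 (norm_nonneg _) (norm_nonneg _)
  have hN := sq_norm_le_add_sq (contract z w 1)
  have hK1 : K⁻¹ = 4 * (4 * K)⁻¹ := by field_simp
  have hK2 : (2 * K)⁻¹ = 2 * (4 * K)⁻¹ := by field_simp; norm_num
  have l1 := (abs_le.1 m1).1
  have lσ := (abs_le.1 mσ).2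
  simp only [Prod.mk.eta] at l1 lσ
  simp only [contract, one_smul] at hle l1 lσ hgood q1 qσ hN ⊢
  rw [mul_assoc] at l1 lσ
  have t1 := mul_le_mul_of_nonneg_left q1 hK4.le
  have tσ := mul_le_mul_of_nonneg_left qσ hK4.le
  have t2 := mul_le_mul_of_nonneg_left hN hK4.le
  rw [hK1] at hgood
  rw [hK2]
  linarith

end Phase

/-! ### The integrand and its antilinear derivative. -/

section Integrand

variable {n : ℕ}

/-- The integrand `e^{2φ(y, ȳ; p)/h} a(p)`. -/
def integrand (Ψ : Cn n × Cn n → ℂ) (a : Cn n × Cn n → ℂ) (y : Cn n) (h : ℝ) (p : Cn n × Cn n) : ℂ :=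
  Complex.exp (2 / (h : ℂ) * phase Ψ (y, conjVec y) p) * a p

/-- The points at which the phase based at `(y, ȳ)` is defined. -/
def phaseDomain (T : Set (Cn n × Cn n)) (y : Cn n) : Set (Cn n × Cn n) :=
  {p | p ∈ T ∧ (p.1, conjVec y) ∈ T ∧ (y, p.2) ∈ T}

theorem isOpen_phaseDomain {T : Set (Cn n × Cn n)} (hT : IsOpen T) (y : Cn n) :
    IsOpen (phaseDomain T y) :=
  hT.inter ((hT.preimage (by fun_prop : Continuous fun p : Cn n × Cn n => (p.1, conjVec y))).inter
    (hT.preimage (by fun_prop : Continuous fun p : Cn n × Cn n => (y, p.2))))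

theorem contDiffOn_phase {Ψ : Cn n × Cn n → ℂ} {T : Set (Cn n × Cn n)} (hΨ : ContDiffOn ℝ ∞ Ψ T)
    (y : Cn n) : ContDiffOn ℝ ∞ (phase Ψ (y, conjVec y)) (phaseDomain T y) := by
  have h1 : ContDiffOn ℝ ∞ (fun p : Cn n × Cn n => Ψ (p.1, p.2)) (phaseDomain T y) :=
    hΨ.mono fun p hp => hp.1
  have h2 : ContDiffOn ℝ ∞ (fun p : Cn n × Cn n => Ψ (p.1, conjVec y)) (phaseDomain T y) :=
    hΨ.comp (by fun_prop) fun p hp => hp.2.1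
  have h3 : ContDiffOn ℝ ∞ (fun p : Cn n × Cn n => Ψ (y, p.2)) (phaseDomain T y) :=
    hΨ.comp (by fun_prop) fun p hp => hp.2.2
  exact ((h1.sub h2).sub h3).add contDiffOn_const

theorem contDiffOn_integrand {Ψ a : Cn n × Cn n → ℂ} {T : Set (Cn n × Cn n)}
    (hΨ : ContDiffOn ℝ ∞ Ψ T) (ha : ContDiffOn ℝ ∞ a T) (y : Cn n) (h : ℝ) :
    ContDiffOn ℝ ∞ (integrand Ψ a y h) (phaseDomain T y) :=
  (contDiffOn_const.mul (contDiffOn_phase hΨ y)).cexp.mul (ha.mono fun _ hp => hp.1)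

theorem norm_integrand (Ψ a : Cn n × Cn n → ℂ) (y : Cn n) (h : ℝ) (p : Cn n × Cn n) :
    ‖integrand Ψ a y h p‖ = Real.exp (2 / h * (phase Ψ (y, conjVec y) p).re) * ‖a p‖ := by
  rw [integrand, norm_mul, Complex.norm_exp]
  congr 2
  rw [← Complex.re_ofReal_mul]
  push_cast
  rfl

/-- Three of the four terms of the phase depend on `p`. Each is evaluated at a point with `|x - conj
ỹ| ≤ 2d`, where `d` is the distance to `(y, ȳ)`. This gives `6n = 3 · 2n` and the argument `2d`. -/
theorem norm_antiPart_phase_le {s C : ℝ} (hs : 1 < s) (hC : 0 < C) {Ψ : Cn n × Cn n → ℂ}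
    {T : Set (Cn n × Cn n)} (hT : IsOpen T) (hΨ : ContDiffOn ℝ ∞ Ψ T) (hf : DbarFlat s C Ψ T)
    {y : Cn n} {p : Cn n × Cn n} (hp : p ∈ phaseDomain T y) (ζ : Cn n × Cn n) :
    ‖antiPart (fderiv ℝ (phase Ψ (y, conjVec y)) p) ζ‖ ≤
      6 * n * flatWeight s C (2 * ‖p - (y, conjVec y)‖) * ‖ζ‖ := by
  set d := ‖p - (y, conjVec y)‖ with hd
  have d1 : ‖p.1 - y‖ ≤ d := norm_fst_le (p - (y, conjVec y))
  have d2 : ‖conjVec p.2 - y‖ ≤ d := by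
    have := norm_snd_le (p - (y, conjVec y))
    rw [← norm_conjVec] at this
    simpa [conjVec_sub] using this
  have diff : ∀ q ∈ T, HasFDerivAt Ψ (fderiv ℝ Ψ q) q := fun q hq =>
    ((hΨ.contDiffAt (hT.mem_nhds hq)).differentiableAt (by simp)).hasFDerivAt
  set P₁ : Cn n × Cn n →L[ℝ] Cn n × Cn n :=
    (ContinuousLinearMap.fst ℝ (Cn n) (Cn n)).prod 0
  set P₂ : Cn n × Cn n →L[ℝ] Cn n × Cn n :=
    (0 : Cn n × Cn n →L[ℝ] Cn n).prod (ContinuousLinearMap.snd ℝ (Cn n) (Cn n))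
  have k1 : HasFDerivAt (fun q : Cn n × Cn n => Ψ (q.1, conjVec y))
      ((fderiv ℝ Ψ (p.1, conjVec y)).comp P₁) p :=
    HasFDerivAt.comp (f := fun q : Cn n × Cn n => (q.1, conjVec y)) p (diff _ hp.2.1)
      (hasFDerivAt_fst.prodMk (hasFDerivAt_const _ _))
  have k2 : HasFDerivAt (fun q : Cn n × Cn n => Ψ (y, q.2))
      ((fderiv ℝ Ψ (y, p.2)).comp P₂) p :=
    HasFDerivAt.comp (f := fun q : Cn n × Cn n => (y, q.2)) p (diff _ hp.2.2)
      ((hasFDerivAt_const _ _).prodMk hasFDerivAt_snd)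
  have hder : HasFDerivAt (phase Ψ (y, conjVec y)) (fderiv ℝ Ψ p -
      (fderiv ℝ Ψ (p.1, conjVec y)).comp P₁ - (fderiv ℝ Ψ (y, p.2)).comp P₂) p :=
    (((diff p hp.1).sub k1).sub k2).add_const _
  have c1 : antiPart ((fderiv ℝ Ψ (p.1, conjVec y)).comp P₁) ζ =
      antiPart (fderiv ℝ Ψ (p.1, conjVec y)) (ζ.1, 0) := by
    simp [antiPart, P₁]
  have c2 : antiPart ((fderiv ℝ Ψ (y, p.2)).comp P₂) ζ =
      antiPart (fderiv ℝ Ψ (y, p.2)) (0, ζ.2) := by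
    simp [antiPart, P₂]
  rw [hder.fderiv, antiPart_sub_left, antiPart_sub_left, c1, c2]
  have gen : ∀ q ∈ T, ‖q.1 - conjVec q.2‖ ≤ 2 * d → ∀ ξ : Cn n × Cn n, ‖ξ‖ ≤ ‖ζ‖ →
      ‖antiPart (fderiv ℝ Ψ q) ξ‖ ≤ 2 * n * flatWeight s C (2 * d) * ‖ζ‖ := by
    intro q hq hqd ξ hξ
    refine (hf.norm_antiPart_le hC hq ξ).trans ?_
    have := flatWeight_mono hs hC (norm_nonneg _) hqd
    have := flatWeight_nonneg (s := s) (t := 2 * d) hC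
    gcongr
  have g0 := gen p hp.1 (by
    have : p.1 - conjVec p.2 = (p.1 - y) - (conjVec p.2 - y) := by abel
    rw [this]; exact (norm_sub_le _ _).trans (by linarith)) ζ le_rfl
  have d0 : 0 ≤ d := norm_nonneg _
  have g1 := gen (p.1, conjVec y) hp.2.1 (by simp only [conjVec_conjVec]; linarith) (ζ.1, 0) (by
    rw [Prod.norm_mk]; simpa using norm_fst_le ζ)
  have g2 := gen (y, p.2) hp.2.2 (by simp only []; rw [norm_sub_rev]; linarith) (0, ζ.2) (by
    rw [Prod.norm_mk]; simpa using norm_snd_le ζ)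
  refine (norm_sub_le _ _).trans ?_
  have := norm_sub_le (antiPart (fderiv ℝ Ψ p) ζ) (antiPart (fderiv ℝ Ψ (p.1, conjVec y)) (ζ.1, 0))
  linarith

theorem norm_antiPart_integrand_le {s C A : ℝ} (hs : 1 < s) (hC : 0 < C)
    {Ψ a : Cn n × Cn n → ℂ}
    {T : Set (Cn n × Cn n)} (hT : IsOpen T) (hΨ : ContDiffOn ℝ ∞ Ψ T) (hf : DbarFlat s C Ψ T)
    (ha : ContDiffOn ℝ ∞ a T) (haf : DbarFlat s C a T) (haA : ∀ p ∈ T, ‖a p‖ ≤ A)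
    {y : Cn n} {p : Cn n × Cn n} (hp : p ∈ phaseDomain T y) {h : ℝ} (hh : 0 < h)
    (ζ : Cn n × Cn n) :
    ‖antiPart (fderiv ℝ (integrand Ψ a y h) p) ζ‖ ≤
      Real.exp (2 / h * (phase Ψ (y, conjVec y) p).re) *
        ((12 * n * A * h⁻¹ + 2 * n) * flatWeight s C (2 * ‖p - (y, conjVec y)‖)) * ‖ζ‖ := by
  have hφ : HasFDerivAt (phase Ψ (y, conjVec y)) (fderiv ℝ (phase Ψ (y, conjVec y)) p) p :=
    (((contDiffOn_phase hΨ y).contDiffAt ((isOpen_phaseDomain hT y).mem_nhds hp)).differentiableAt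
      (by simp)).hasFDerivAt
  have ha' : HasFDerivAt a (fderiv ℝ a p) p :=
    ((ha.contDiffAt (hT.mem_nhds hp.1)).differentiableAt (by simp)).hasFDerivAt
  have hder := ((hφ.const_mul (2 / (h : ℂ))).cexp).mul ha'
  have heq : fderiv ℝ (integrand Ψ a y h) p = _ := hder.fderiv
  set w := Complex.exp (2 / (h : ℂ) * phase Ψ (y, conjVec y) p) with hw
  have hwn : ‖w‖ = Real.exp (2 / h * (phase Ψ (y, conjVec y) p).re) := by
    have := norm_integrand Ψ (fun _ => 1) y h p
    simpa [integrand] using this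
  rw [heq, antiPart_add_left, antiPart_smul_left, antiPart_smul_left, antiPart_smul_left,
    antiPart_smul_left]
  set d := ‖p - (y, conjVec y)‖ with hd
  have d1 : ‖p.1 - y‖ ≤ d := norm_fst_le (p - (y, conjVec y))
  have d2 : ‖conjVec p.2 - y‖ ≤ d := by
    have := norm_snd_le (p - (y, conjVec y))
    rw [← norm_conjVec] at this
    simpa [conjVec_sub] using this
  have b1 := norm_antiPart_phase_le hs hC hT hΨ hf hp ζ
  have b2 : ‖antiPart (fderiv ℝ a p) ζ‖ ≤ 2 * n * flatWeight s C (2 * d) * ‖ζ‖ := by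
    refine (haf.norm_antiPart_le hC hp.1 ζ).trans ?_
    have : ‖p.1 - conjVec p.2‖ ≤ 2 * d := by
      have : p.1 - conjVec p.2 = (p.1 - y) - (conjVec p.2 - y) := by abel
      rw [this]; exact (norm_sub_le _ _).trans (by linarith)
    have := flatWeight_mono hs hC (norm_nonneg _) this
    gcongr
  have b3 := haA p hp.1
  have hA : 0 ≤ A := (norm_nonneg _).trans b3
  have hfw := flatWeight_nonneg (s := s) (t := 2 * d) hC
  have h2 : ‖(2 / (h : ℂ))‖ = 2 * h⁻¹ := by
    rw [norm_div]; simp [abs_of_pos hh, div_eq_mul_inv]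
  refine (norm_add_le _ _).trans ?_
  simp only [norm_mul]
  rw [← hwn, h2]
  calc ‖w‖ * ‖antiPart (fderiv ℝ a p) ζ‖ + ‖a p‖ * (‖w‖ * (2 * h⁻¹ *
        ‖antiPart (fderiv ℝ (phase Ψ (y, conjVec y)) p) ζ‖))
      ≤ ‖w‖ * (2 * n * flatWeight s C (2 * d) * ‖ζ‖) + A * (‖w‖ * (2 * h⁻¹ *
        (6 * n * flatWeight s C (2 * d) * ‖ζ‖))) := by gcongr
    _ = _ := by ring

/-- The exponential rate produced by a Gaussian of strength `K⁻¹` and a flat weight with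
constant `C`. -/
def rate (s K C : ℝ) : ℝ := min K⁻¹ (C⁻¹ * 2 ^ (-(1 / (s - 1))))

theorem rate_pos {s K C : ℝ} (hK : 0 < K) (hC : 0 < C) : 0 < rate s K C :=
  lt_min (by positivity) (by positivity)

/-- This is where the exponent `1/(2s-1)` enters. At `d = 0` the weight itself vanishes; for `d > 0`
the balance estimate applies, and the argument `2d` accounts for the power of `2` in `rate`. -/
theorem gauss_mul_flatWeight_le {s K C : ℝ} (hs : 1 < s) (hK : 0 < K) (hC : 0 < C) {d h x : ℝ}
    (hd : 0 ≤ d) (hh : 0 < h) (hx : x ≤ -((2 * K)⁻¹ * d ^ 2)) :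
    Real.exp (2 / h * x) * flatWeight s C (2 * d) ≤
      C * Real.exp (-(rate s K C * h ^ (-(1 / (2 * s - 1))))) := by
  rcases hd.eq_or_lt with rfl | hd
  · simp only [mul_zero, flatWeight_zero]; positivity
  · rw [flatWeight, if_neg (by positivity)]
    rw [mul_left_comm, ← Real.exp_add]
    gcongr
    have key := min_mul_rpow_le_gauss_add_flat (A := K⁻¹) (B := C⁻¹ * 2 ^ (-(1 / (s - 1)))) hs
      (by positivity) (by positivity) hd hh
    have e1 : 2 / h * x ≤ -(K⁻¹ * d ^ 2 / h) := by
      have : 2 / h * x ≤ 2 / h * -((2 * K)⁻¹ * d ^ 2) := by gcongr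
      refine this.trans_eq ?_
      field_simp
    rw [Real.mul_rpow (by norm_num) hd.le, ← mul_assoc]
    unfold rate
    linarith

end Integrand

/-! ### Coordinates, the holomorphic volume form and the splitting of directions. -/

section Coordinates

variable {n : ℕ}

/-- The complex coordinates of `ℂⁿ × ℂⁿ`. -/
def coordL (n : ℕ) : Cn n × Cn n →ₗ[ℂ] (Fin n ⊕ Fin n → ℂ) where
  toFun ζ := Sum.elim (fun j => ζ.1 j) (fun j => ζ.2 j)
  map_add' ζ η := by ext i; cases i <;> simp
  map_smul' c ζ := by ext i; cases i <;> simp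

theorem coordL_injective : Function.Injective (coordL n) := by
  intro ζ η h
  ext j
  · exact congrFun h (Sum.inl j)
  · exact congrFun h (Sum.inr j)

/-- The form `dx_1 ∧ … ∧ dx_n ∧ dỹ_1 ∧ … ∧ dỹ_n`. -/
def jacForm (n : ℕ) : (Cn n × Cn n) [⋀^Fin n ⊕ Fin n]→L[ℝ] ℂ :=
  { ((Matrix.detRowAlternating (R := ℂ) (n := Fin n ⊕ Fin n)).compLinearMap
      (coordL n)).restrictScalars ℝ with
    map_eq_zero_of_eq' := ((Matrix.detRowAlternating (R := ℂ) (n := Fin n ⊕ Fin n)).compLinearMap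
      (coordL n)).map_eq_zero_of_eq'
    cont := by
      have h : Continuous fun c : Fin n ⊕ Fin n → Cn n × Cn n =>
          (Matrix.of fun k i => coordL n (c k) i).det := by
        refine Continuous.matrix_det (continuous_matrix fun k i => ?_)
        cases i <;> simp only [coordL, LinearMap.coe_mk, AddHom.coe_mk, Sum.elim_inl,
          Sum.elim_inr, Matrix.of_apply] <;> fun_prop
      exact h }

theorem jacForm_apply (c : Fin n ⊕ Fin n → Cn n × Cn n) :
    jacForm n c = (Matrix.of fun i k => coordL n (c k) i).det := by
  rw [← Matrix.det_transpose]; rfl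

theorem jac_eq_jacForm (Γ : Contour n) (y : Cn n) (t : R2n n) :
    Γ.jac y t = jacForm n (Γ.partial y t) := by
  rw [jacForm_apply]; rfl

theorem satisfiesCramer_jacForm : SatisfiesCramer (jacForm n) := by
  intro c v
  apply coordL_injective
  rw [map_smul, map_sum]
  set M : Matrix (Fin n ⊕ Fin n) (Fin n ⊕ Fin n) ℂ := Matrix.of fun i k => coordL n (c k) i with hM
  have h := Matrix.mulVec_cramer M (coordL n v)
  rw [jacForm_apply, ← hM, ← h]
  have hk : ∀ k, jacForm n (Function.update c k v) = M.cramer (coordL n v) k := by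
    intro k
    rw [Matrix.cramer_apply, jacForm_apply]
    congr 1
    ext i l
    by_cases hl : l = k
    · subst hl; simp
    · simp [hM, hl]
  simp only [hk, map_smul]
  ext i
  simp [Matrix.mulVec, dotProduct, hM, mul_comm]

/-- The projection onto the tangent directions `(z, -z̄)` of the affine contour. -/
def minusPart (n : ℕ) : Cn n × Cn n →L[ℝ] Cn n × Cn n :=
  (1 / 2 : ℝ) • ((ContinuousLinearMap.fst ℝ (Cn n) (Cn n) -
      (conjL n).toContinuousLinearMap.comp (ContinuousLinearMap.snd ℝ (Cn n) (Cn n))).prod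
    (ContinuousLinearMap.snd ℝ (Cn n) (Cn n) -
      (conjL n).toContinuousLinearMap.comp (ContinuousLinearMap.fst ℝ (Cn n) (Cn n))))

/-- The projection onto the directions `(w, w̄)` of the anti-diagonal. -/
def plusPart (n : ℕ) : Cn n × Cn n →L[ℝ] Cn n × Cn n :=
  (1 / 2 : ℝ) • ((ContinuousLinearMap.fst ℝ (Cn n) (Cn n) +
      (conjL n).toContinuousLinearMap.comp (ContinuousLinearMap.snd ℝ (Cn n) (Cn n))).prod
    (ContinuousLinearMap.snd ℝ (Cn n) (Cn n) +
      (conjL n).toContinuousLinearMap.comp (ContinuousLinearMap.fst ℝ (Cn n) (Cn n))))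

theorem minusPart_apply (e : Cn n × Cn n) :
    minusPart n e = (1 / 2 : ℝ) • (e.1 - conjVec e.2, e.2 - conjVec e.1) := rfl

theorem plusPart_apply (e : Cn n × Cn n) :
    plusPart n e = (1 / 2 : ℝ) • (e.1 + conjVec e.2, e.2 + conjVec e.1) := rfl

theorem minusPart_add_plusPart (e : Cn n × Cn n) : minusPart n e + plusPart n e = e := by
  rw [minusPart_apply, plusPart_apply]
  ext1
  · simp only [Prod.fst_add, Prod.smul_fst]; module
  · simp only [Prod.snd_add, Prod.smul_snd]; module

theorem minusPart_add_smul_plusPart (e : Cn n × Cn n) (σ : ℝ) :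
    minusPart n e + σ • plusPart n e =
      contract ((1 / 2 : ℝ) • (e.1 - conjVec e.2)) ((1 / 2 : ℝ) • (e.1 + conjVec e.2)) σ := by
  rw [minusPart_apply, plusPart_apply, contract]
  ext1
  · simp only [Prod.fst_add, Prod.smul_fst]
  · simp only [Prod.snd_add, Prod.smul_snd, conjVec_sub, conjVec_smul, conjVec_add,
      conjVec_conjVec]
    module

theorem contract_one_eq (e : Cn n × Cn n) :
    contract ((1 / 2 : ℝ) • (e.1 - conjVec e.2)) ((1 / 2 : ℝ) • (e.1 + conjVec e.2)) 1 = e := by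
  rw [← minusPart_add_smul_plusPart, one_smul, minusPart_add_plusPart]

theorem norm_minusPart_add_smul_plusPart_le (e : Cn n × Cn n) {σ : ℝ} (h0 : 0 ≤ σ) (h1 : σ ≤ 1) :
    ‖minusPart n e + σ • plusPart n e‖ ≤ ‖e‖ := by
  have := norm_contract_le (z := (1 / 2 : ℝ) • (e.1 - conjVec e.2))
    (w := (1 / 2 : ℝ) • (e.1 + conjVec e.2)) h0 h1
  rw [contract_one_eq, ← minusPart_add_smul_plusPart] at this
  exact max_le this.1 this.2

theorem norm_minusPart_le (e : Cn n × Cn n) : ‖minusPart n e‖ ≤ ‖e‖ := by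
  simpa using norm_minusPart_add_smul_plusPart_le e le_rfl zero_le_one

theorem norm_plusPart_le (e : Cn n × Cn n) : ‖plusPart n e‖ ≤ ‖e‖ := by
  have a1 := norm_fst_le e
  have a2 := norm_snd_le e
  rw [plusPart_apply, norm_smul, Prod.norm_mk]
  have b1 : ‖e.1 + conjVec e.2‖ ≤ 2 * ‖e‖ := by
    refine (norm_add_le _ _).trans ?_
    rw [norm_conjVec]; linarith
  have b2 : ‖e.2 + conjVec e.1‖ ≤ 2 * ‖e‖ := by
    refine (norm_add_le _ _).trans ?_
    rw [norm_conjVec]; linarith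
  have := max_le b1 b2
  rw [Real.norm_of_nonneg (by norm_num)]
  linarith

/-- The real coordinates of `ℂⁿ`. -/
def realCoord (n : ℕ) : Cn n →ₗ[ℝ] R2n n where
  toFun q := WithLp.toLp 2 (Sum.elim (fun j => (q j).re) (fun j => (q j).im))
  map_add' p q := by ext i; cases i <;> simp
  map_smul' c q := by ext i; cases i <;> simp

theorem norm_realCoord (q : Cn n) : ‖realCoord n q‖ = ‖q‖ := by
  rw [EuclideanSpace.norm_eq, EuclideanSpace.norm_eq]
  congr 1
  simp only [realCoord, LinearMap.coe_mk, AddHom.coe_mk, Fintype.sum_sum_type, Sum.elim_inl,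
    Sum.elim_inr, Real.norm_eq_abs, sq_abs, ← Finset.sum_add_distrib]
  refine Finset.sum_congr rfl fun j _ => ?_
  rw [Complex.sq_norm, Complex.normSq_apply]
  ring

/-- The point of `ℂⁿ` with given real coordinates. -/
def complexOf (n : ℕ) : R2n n →ₗ[ℝ] Cn n where
  toFun t := WithLp.toLp 2 (fun j => (t (Sum.inl j) : ℂ) + (t (Sum.inr j) : ℂ) * Complex.I)
  map_add' p q := by ext i; simp; ring
  map_smul' c q := by ext i; simp; ring

theorem complexOf_realCoord (q : Cn n) : complexOf n (realCoord n q) = q := by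
  ext j; simp [complexOf, realCoord]

/-- The map `(x, ỹ) ↦ x - conj ỹ` in real coordinates. -/
def offsetL (n : ℕ) : Cn n × Cn n →L[ℝ] R2n n :=
  (LinearMap.toContinuousLinearMap (realCoord n)).comp (ContinuousLinearMap.fst ℝ (Cn n) (Cn n) -
      (conjL n).toContinuousLinearMap.comp (ContinuousLinearMap.snd ℝ (Cn n) (Cn n)))

theorem offsetL_apply (e : Cn n × Cn n) : offsetL n e = realCoord n (e.1 - conjVec e.2) := rfl

theorem norm_offsetL_le (e : Cn n × Cn n) : ‖offsetL n e‖ ≤ 2 * ‖e‖ := by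
  rw [offsetL_apply, norm_realCoord]
  refine (norm_sub_le _ _).trans ?_
  rw [norm_conjVec]
  linarith [norm_fst_le e, norm_snd_le e]

/-- The affine contour `t ↦ (z, -z̄)`, `2 z = complexOf t`. -/
def affineContour (n : ℕ) (t : R2n n) : Cn n × Cn n :=
  (1 / 2 : ℝ) • (complexOf n t, -conjVec (complexOf n t))

theorem affineContour_offsetL (e : Cn n × Cn n) : affineContour n (offsetL n e) = minusPart n e := by
  rw [affineContour, offsetL_apply, complexOf_realCoord, minusPart_apply, conjVec_sub,
    conjVec_conjVec, neg_sub]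

/-- The matrix of the inclusion of the affine contour. -/
def affineMatrix (n : ℕ) : Matrix (Fin n ⊕ Fin n) (Fin n ⊕ Fin n) ℂ :=
  Matrix.fromBlocks (Matrix.diagonal fun _ => 1 / 2) (Matrix.diagonal fun _ => Complex.I / 2)
    (Matrix.diagonal fun _ => -1 / 2) (Matrix.diagonal fun _ => Complex.I / 2)

/-- The real matrix of the vectors `x - conj ỹ` of a frame. -/
def offsetMatrix (c : Fin n ⊕ Fin n → Cn n × Cn n) : Matrix (Fin n ⊕ Fin n) (Fin n ⊕ Fin n) ℝ :=
  Matrix.of fun i k => offsetL n (c k) i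

theorem orientMatrix_eq (Γ : Contour n) (y : Cn n) :
    Γ.orientMatrix y = offsetMatrix (Γ.partial y 0) := by
  ext i k
  cases i <;> simp [Contour.orientMatrix, offsetMatrix, offsetL_apply, realCoord]

/-- The projection to the affine directions factors through the real offset `x - conj ỹ`. The
complex Jacobian is therefore a constant times a real determinant, which is what a real change of
variables requires. -/
theorem jacForm_minusPart (c : Fin n ⊕ Fin n → Cn n × Cn n) :
    jacForm n (fun k => minusPart n (c k)) =
      (affineMatrix n).det * ((offsetMatrix c).det : ℂ) := by
  have h : (((offsetMatrix c).det : ℝ) : ℂ) = ((offsetMatrix c).map Complex.ofReal).det :=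
    RingHom.map_det Complex.ofRealHom (offsetMatrix c)
  rw [h, ← Matrix.det_mul, jacForm_apply]
  congr 1
  ext i k
  rw [Matrix.mul_apply, Fintype.sum_sum_type]
  have e : ∀ q : ℂ, (q.re : ℂ) + q.im * Complex.I = q := Complex.re_add_im
  have e' : ∀ q : ℂ, (starRingEnd ℂ) q = q.re - q.im * Complex.I := fun q => by
    apply Complex.ext <;> simp
  cases i with
  | inl j =>
    simp [affineMatrix, offsetMatrix, offsetL_apply, realCoord, minusPart_apply, coordL,
      Matrix.diagonal_apply]
    conv_lhs => rw [← e ((c k).1 j), e' ((c k).2 j)]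
    ring
  | inr j =>
    simp [affineMatrix, offsetMatrix, offsetL_apply, realCoord, minusPart_apply, coordL,
      Matrix.diagonal_apply]
    conv_lhs => rw [← e ((c k).2 j), e' ((c k).1 j)]
    ring

theorem det_eq_det_offsetMatrix (L : R2n n →L[ℝ] Cn n × Cn n) :
    ((offsetL n).comp L).det = (offsetMatrix fun k => L (dir k)).det := by
  rw [ContinuousLinearMap.det, ← LinearMap.det_toMatrix
    (EuclideanSpace.basisFun (Fin n ⊕ Fin n) ℝ).toBasis]
  congr 1

end Coordinates

/-! ### The inverse function theorem with uniform radii. -/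

section InverseFunction

open Filter Topology Set

variable {X Y : Type*} [NormedAddCommGroup X] [NormedSpace ℝ X] [FiniteDimensional ℝ X]
  [TopologicalSpace Y]

/-- The inverse function theorem with parameters, with uniform radii. -/
theorem exists_uniform_inverse {Z : Y → X → X} {Z' : Y → X → X →L[ℝ] X} {y₀ : Y}
    (hder : ∀ᶠ p : Y × X in 𝓝 (y₀, 0), HasFDerivAt (Z p.1) (Z' p.1 p.2) p.2)
    (hcont : ContinuousAt (fun p : Y × X => Z' p.1 p.2) (y₀, 0)) (hdet : 0 < (Z' y₀ 0).det) :
    ∃ r₀ > 0, ∃ m > 0, ∀ᶠ y in 𝓝 y₀, InjOn (Z y) (Metric.ball 0 r₀) ∧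
      (∀ t ∈ Metric.ball (0 : X) r₀, HasFDerivAt (Z y) (Z' y t) t ∧ 0 < (Z' y t).det) ∧
      ∀ r, 0 < r → r < r₀ →
        Metric.closedBall (Z y 0) (m * r) ⊆ Z y '' Metric.closedBall 0 r := by
  have : CompleteSpace X := FiniteDimensional.complete ℝ X
  set A : X ≃L[ℝ] X := (Z' y₀ 0).toContinuousLinearEquivOfDetNeZero hdet.ne' with hA
  have hA' : (A : X →L[ℝ] X) = Z' y₀ 0 := by ext v; simp [hA]
  -- Adding `1` keeps `N` positive even in dimension zero. With `c = N⁻¹/2`, the image of a ball of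
  -- radius `r` contains one of radius `(N⁻¹ - c) r = N⁻¹ r / 2`.
  set N : NNReal := ‖(A.symm : X →L[ℝ] X)‖₊ + 1 with hN
  have hNpos : 0 < N := by positivity
  set c : NNReal := N⁻¹ / 2 with hc
  have hcpos : 0 < c := by positivity
  have hdetc : ContinuousAt (fun p : Y × X => (Z' p.1 p.2).det) (y₀, 0) :=
    ContinuousAt.comp (f := fun p : Y × X => Z' p.1 p.2)
      ContinuousLinearMap.continuous_det.continuousAt hcont
  have h1 : ∀ᶠ p : Y × X in 𝓝 (y₀, 0), 0 < (Z' p.1 p.2).det :=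
    continuousAt_const.eventually_lt hdetc hdet
  have h2 : ∀ᶠ p : Y × X in 𝓝 (y₀, 0), ‖Z' p.1 p.2 - Z' y₀ 0‖ < c :=
    (hcont.sub continuousAt_const).norm.eventually_lt continuousAt_const (by simpa using hcpos)
  have hall := hder.and (h1.and h2)
  rw [nhds_prod_eq] at hall
  obtain ⟨P, hP, Q, hQ, hPQ⟩ := eventually_prod_iff.1 hall
  obtain ⟨r₀, hr₀, hball⟩ := Metric.eventually_nhds_iff_ball.1 hQ
  refine ⟨r₀, hr₀, (N : ℝ)⁻¹ / 2, by positivity, ?_⟩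
  filter_upwards [hP] with y hy
  have hap : ApproximatesLinearOn (Z y) (A : X →L[ℝ] X) (Metric.ball 0 r₀) c := by
    intro x hx x' hx'
    refine Convex.norm_image_sub_le_of_norm_hasFDerivWithin_le' (s := Metric.ball 0 r₀)
      (f' := fun t => Z' y t) (fun t ht => (hPQ hy (hball t ht)).1.hasFDerivWithinAt)
      (fun t ht => ?_) (convex_ball 0 r₀) hx' hx
    rw [hA']
    exact (hPQ hy (hball t ht)).2.2.le
  refine ⟨?_, fun t ht => ⟨(hPQ hy (hball t ht)).1, (hPQ hy (hball t ht)).2.1⟩, ?_⟩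
  · refine hap.injOn ?_
    rcases subsingleton_or_nontrivial X with hX | hX
    · exact Or.inl hX
    · right
      have hpos : 0 < ‖(A.symm : X →L[ℝ] X)‖₊ := A.nnnorm_symm_pos
      calc c < N⁻¹ := NNReal.half_lt_self (by positivity)
        _ ≤ ‖(A.symm : X →L[ℝ] X)‖₊⁻¹ := by
          gcongr
          exact le_self_add
  · intro r hr hrr
    let B : (A : X →L[ℝ] X).NonlinearRightInverse :=
      { toFun := A.symm
        nnnorm := N
        bound' := fun v => ((A.symm : X →L[ℝ] X).le_opNorm v).trans (by
          gcongr
          simp [hN])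
        right_inv' := A.apply_symm_apply }
    have := hap.surjOn_closedBall_of_nonlinearRightInverse B hr.le
      (Metric.closedBall_subset_ball hrr)
    have e : ((B.nnnorm : ℝ)⁻¹ - c) * r = (N : ℝ)⁻¹ / 2 * r := by
      have : (B.nnnorm : ℝ) = N := rfl
      rw [this, hc]; push_cast; ring
    rw [e] at this
    exact this

end InverseFunction

/-! ### Deformation of one contour integral to the affine disc. -/

section ContourIntegral

open MeasureTheory Set Metric

variable {n : ℕ}

theorem norm_alternating_le {ι E : Type*} [Fintype ι] [NormedAddCommGroup E] [NormedSpace ℝ E]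
    (D : E [⋀^ι]→L[ℝ] ℂ) {c : ι → E} {R : ℝ} (hc : ∀ k, ‖c k‖ ≤ R) :
    ‖D c‖ ≤ ‖D‖ * R ^ Fintype.card ι := by
  refine (D.le_opNorm c).trans ?_
  gcongr
  calc ∏ k, ‖c k‖ ≤ ∏ _k : ι, R := Finset.prod_le_prod (fun _ _ => norm_nonneg _) fun k _ => hc k
    _ = _ := by simp

/-- Comparison of the integral over a contour, centred at `c`, with the one over a piece of the
affine contour, for a function `F` which is small away from `c` and almost holomorphic near `c`. -/
theorem norm_contour_integral_sub_le {g : R2n n → Cn n × Cn n} {c : Cn n × Cn n}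
    {Q O : Set (R2n n)} (hQ : IsCompact Q) (hO : IsOpen O) (hQO : Q ⊆ O) (hg : ContDiffOn ℝ ∞ g O)
    {F : Cn n × Cn n → ℂ} {T : Set (Cn n × Cn n)} (hT : IsOpen T) (hF : ContDiffOn ℝ 1 F T)
    (hQT : ∀ t ∈ Q, g t ∈ T) {r δ : ℝ} (hr : 0 < r) (hWQ : ball 0 (2 * r) ⊆ Q)
    (hmem : ∀ σ ∈ Ioo (-1 : ℝ) 2, ∀ t ∈ ball (0 : R2n n) (2 * r),
      c + minusPart n (g t - c) + σ • plusPart n (g t - c) ∈ T)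
    {θ : R2n n → ℝ} (hθ : ContDiff ℝ 1 θ) (hθs : tsupport θ ⊆ closedBall 0 (3 / 2 * r))
    (hθ0 : ∀ t, 0 ≤ θ t) (hθ1 : ∀ t, θ t ≤ 1) (hθr : ∀ t ∈ closedBall (0 : R2n n) r, θ t = 1)
    {R X Y Θ : ℝ} (hΘ : ∀ t k, ‖fderiv ℝ θ t (dir k)‖ ≤ Θ)
    (hR : ∀ t ∈ Q, ∀ k, ‖fderiv ℝ g t (dir k)‖ ≤ R)
    (hR' : ∀ t ∈ ball (0 : R2n n) (2 * r), ‖g t - c‖ ≤ R)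
    (hX0 : 0 ≤ X) (hY0 : 0 ≤ Y)
    (hX : ∀ t ∈ Q, t ∉ ball (0 : R2n n) r → ‖F (g t)‖ ≤ X)
    (hXσ : ∀ σ ∈ Icc (0 : ℝ) 1, ∀ t ∈ ball (0 : R2n n) (2 * r), t ∉ ball (0 : R2n n) r →
      ‖F (c + minusPart n (g t - c) + σ • plusPart n (g t - c))‖ ≤ X)
    (hXδ : ∀ t ∈ ball (0 : R2n n) (2 * r), δ ≤ ‖offsetL n (g t - c)‖ →
      ‖F (c + minusPart n (g t - c))‖ ≤ X)
    (hY : ∀ σ ∈ Icc (0 : ℝ) 1, ∀ t ∈ ball (0 : R2n n) (2 * r), ∀ ζ,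
      ‖antiPart (fderiv ℝ F (c + minusPart n (g t - c) + σ • plusPart n (g t - c))) ζ‖ ≤ Y * ‖ζ‖)
    (hinj : InjOn (fun t => offsetL n (g t - c)) (ball 0 (2 * r)))
    (hdet : ∀ t ∈ ball (0 : R2n n) (2 * r), 0 < ((offsetL n).comp (fderiv ℝ g t)).det)
    (hsurj : ball 0 δ ⊆ (fun t => offsetL n (g t - c)) '' closedBall 0 r) :
    ‖(∫ t in Q, F (g t) * jacForm n (fun k => fderiv ℝ g t (dir k))) -
        (affineMatrix n).det * ∫ u in ball (0 : R2n n) δ, F (c + affineContour n u)‖ ≤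
      (2 * X + (Fintype.card (Fin n ⊕ Fin n) + 1) * (Y * R) +
        Fintype.card (Fin n ⊕ Fin n) * (Θ * X)) *
        (‖jacForm n‖ * R ^ Fintype.card (Fin n ⊕ Fin n)) * volume.real Q := by
  set W : Set (R2n n) := ball 0 (2 * r) with hW
  have hWo : IsOpen W := isOpen_ball
  have hWO : W ⊆ O := hWQ.trans hQO
  set J : ℝ := ‖jacForm n‖ * R ^ Fintype.card (Fin n ⊕ Fin n) with hJ
  have h0W : (0 : R2n n) ∈ W := mem_ball_self (by positivity)
  have hR0 : 0 ≤ R := (norm_nonneg _).trans (hR' 0 h0W)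
  have hJ0 : 0 ≤ J := by positivity
  have hΘ0 : 0 ≤ ((Fintype.card (Fin n ⊕ Fin n) : ℝ)) * Θ := by
    have : ∑ k : Fin n ⊕ Fin n, ‖fderiv ℝ θ 0 (dir k)‖ ≤ ∑ _k : Fin n ⊕ Fin n, Θ :=
      Finset.sum_le_sum fun k _ => hΘ 0 k
    simp only [Finset.sum_const, Finset.card_univ, nsmul_eq_mul] at this
    exact (Finset.sum_nonneg fun k _ => norm_nonneg _).trans this
  have hSW : tsupport θ ⊆ W := hθs.trans (closedBall_subset_ball (by linarith))
  have hcs : HasCompactSupport θ :=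
    (isCompact_closedBall (0 : R2n n) (3 / 2 * r)).of_isClosed_subset (isClosed_tsupport θ) hθs
  have hzero : ∀ t ∉ tsupport θ, θ t = 0 := fun t ht => image_eq_zero_of_notMem_tsupport ht
  set γ : R2n n → Cn n × Cn n := fun t => c + minusPart n (g t - c) with hγ
  set η : R2n n → Cn n × Cn n := fun t => plusPart n (g t - c) with hη
  have hgd : ∀ t ∈ O, HasFDerivAt g (fderiv ℝ g t) t := fun t ht =>
    ((hg.contDiffAt (hO.mem_nhds ht)).differentiableAt (by simp)).hasFDerivAt
  have dγ : ∀ t ∈ O, fderiv ℝ γ t = (minusPart n).comp (fderiv ℝ g t) := fun t ht =>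
    (((minusPart n).hasFDerivAt.comp t ((hgd t ht).sub_const c)).const_add c).fderiv
  have dη : ∀ t ∈ O, fderiv ℝ η t = (plusPart n).comp (fderiv ℝ g t) := fun t ht =>
    ((plusPart n).hasFDerivAt.comp t ((hgd t ht).sub_const c)).fderiv
  have hcol : ∀ t ∈ O, ∀ σ k, homCol γ η σ t k =
      minusPart n (fderiv ℝ g t (dir k)) + σ • plusPart n (fderiv ℝ g t (dir k)) := by
    intro t ht σ k
    rw [homCol, dγ t ht, dη t ht]; rfl
  have hcolR : ∀ t ∈ W, ∀ σ ∈ Icc (0 : ℝ) 1, ∀ k, ‖homCol γ η σ t k‖ ≤ R := by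
    intro t ht σ hσ k
    rw [hcol t (hWO ht)]
    exact (norm_minusPart_add_smul_plusPart_le _ hσ.1 hσ.2).trans (hR t (hWQ ht) k)
  have hηR : ∀ t ∈ W, ‖η t‖ ≤ R := fun t ht => (norm_plusPart_le _).trans (hR' t ht)
  have cγ : ContDiffOn ℝ ∞ γ W :=
    contDiffOn_const.add ((minusPart n).contDiff.comp_contDiffOn
      ((hg.mono hWO).sub contDiffOn_const))
  have cη : ContDiffOn ℝ ∞ η W :=
    (plusPart n).contDiff.comp_contDiffOn ((hg.mono hWO).sub contDiffOn_const)
  have hγη : ∀ t, γ t + (1 : ℝ) • η t = g t := by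
    intro t
    simp only [hγ, hη, one_smul, add_assoc, minusPart_add_plusPart, add_sub_cancel]
  -- the homotopy
  have hstokes := norm_integral_homotopy_sub_le (satisfiesCramer_jacForm (n := n)) hWo hT
    (cγ.of_le (by norm_cast)) (cη.of_le (by norm_cast)) hF hmem hθ hcs hSW
    (Q := ((Fintype.card (Fin n ⊕ Fin n) + 1) * (Y * R) +
        Fintype.card (Fin n ⊕ Fin n) * (Θ * X)) * J) (by
      intro σ hσ t ht
      have htW := hSW ht
      have hJc : ‖jacForm n (homCol γ η σ t)‖ ≤ J := norm_alternating_le _ (hcolR t htW σ hσ)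
      have hJu : ∀ k, ‖jacForm n (Function.update (homCol γ η σ t) k (η t))‖ ≤ J := by
        intro k
        refine norm_alternating_le _ fun l => ?_
        by_cases hl : l = k
        · subst hl; simpa using hηR t htW
        · simpa [Function.update_of_ne hl] using hcolR t htW σ hσ l
      have herr : ‖stokesErr (jacForm n) F γ η σ t‖ ≤
          (Fintype.card (Fin n ⊕ Fin n) + 1) * (Y * R * J) := by
        refine (norm_sub_le _ _).trans ?_
        have a1 : ‖antiPart (fderiv ℝ F (γ t + σ • η t)) (η t) * jacForm n (homCol γ η σ t)‖ ≤
            Y * R * J := by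
          rw [norm_mul]
          refine mul_le_mul ((hY σ hσ t htW _).trans ?_) hJc (norm_nonneg _) (by positivity)
          exact mul_le_mul_of_nonneg_left (hηR t htW) hY0
        have a2 : ‖∑ k, antiPart (fderiv ℝ F (γ t + σ • η t)) (homCol γ η σ t k) *
            jacForm n (Function.update (homCol γ η σ t) k (η t))‖ ≤
            ∑ _k : Fin n ⊕ Fin n, Y * R * J := by
          refine norm_sum_le_of_le _ fun k _ => ?_
          rw [norm_mul]
          refine mul_le_mul ((hY σ hσ t htW _).trans ?_) (hJu k) (norm_nonneg _) (by positivity)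
          exact mul_le_mul_of_nonneg_left (hcolR t htW σ hσ k) hY0
        simp only [Finset.sum_const, Finset.card_univ, nsmul_eq_mul] at a2
        linarith
      have hbd : ‖∑ k, fderiv ℝ θ t (dir k) •
          (F (γ t + σ • η t) * jacForm n (Function.update (homCol γ η σ t) k (η t)))‖ ≤
          ∑ _k : Fin n ⊕ Fin n, Θ * (X * J) := by
        refine norm_sum_le_of_le _ fun k _ => ?_
        have hΘk := (norm_nonneg _).trans (hΘ t k)
        rw [norm_smul]
        -- The derivative of `θ` vanishes where `θ` is locally `1`. Only the region outside the ball
        -- of radius `r` matters, and there `F` is bounded by `X` along the whole homotopy.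
        by_cases htr : t ∈ ball (0 : R2n n) r
        · have : fderiv ℝ θ t = 0 := by
            have h1 : θ =ᶠ[nhds t] fun _ => 1 := by
              filter_upwards [isOpen_ball.mem_nhds htr] with x hx
              exact hθr x (ball_subset_closedBall hx)
            rw [h1.fderiv_eq]; simp
          rw [this]
          simp only [zero_apply, norm_zero, zero_mul]
          positivity
        · refine mul_le_mul (hΘ t k) ?_ (norm_nonneg _) hΘk
          rw [norm_mul]
          exact mul_le_mul (hXσ σ hσ t htW htr) (hJu k) (norm_nonneg _) hX0
      simp only [Finset.sum_const, Finset.card_univ, nsmul_eq_mul] at hbd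
      refine (norm_sub_le _ _).trans ?_
      have hθe : ‖θ t • stokesErr (jacForm n) F γ η σ t‖ ≤
          ‖stokesErr (jacForm n) F γ η σ t‖ := by
        rw [norm_smul, Real.norm_of_nonneg (hθ0 t)]
        exact mul_le_of_le_one_left (norm_nonneg _) (hθ1 t)
      linarith)
  -- the end of the homotopy
  set f₁ : R2n n → ℂ := fun t => F (g t) * jacForm n (fun k => fderiv ℝ g t (dir k)) with hf₁
  have hf₁O : ContinuousOn f₁ Q := by
    refine (hF.continuousOn.comp (hg.continuousOn.mono hQO) hQT).mul
      ((jacForm n).cont.comp_continuousOn (continuousOn_pi.2 fun k => ?_))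
    exact ((hg.continuousOn_fderiv_of_isOpen hO (by simp)).mono hQO).clm_apply continuousOn_const
  have hf₁eq : ∀ t, θ t • (F (γ t + (1 : ℝ) • η t) * jacForm n (homCol γ η 1 t)) =
      θ t • f₁ t := by
    intro t
    by_cases ht : t ∈ tsupport θ
    · rw [hγη, hf₁]
      congr 3
      funext k
      rw [hcol t (hWO (hSW ht)), one_smul, minusPart_add_plusPart]
    · simp [hzero t ht]
  have iθf₁ : Integrable fun t => θ t • f₁ t :=
    integrable_smul_of_tsupport_subset hWo hθ.continuous hcs hSW (hf₁O.mono hWQ)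
  have step₁ : ‖(∫ t in Q, f₁ t) - ∫ t, θ t • f₁ t‖ ≤ X * J * volume.real Q := by
    rw [← setIntegral_eq_integral_of_forall_compl_eq_zero (s := Q) (f := fun t => θ t • f₁ t)
      (fun t ht => by rw [hzero t fun h => ht (hWQ (hSW h)), zero_smul]),
      ← integral_sub (hf₁O.integrableOn_compact hQ) iθf₁.integrableOn]
    refine norm_setIntegral_le_of_norm_le_const hQ.measure_lt_top fun t ht => ?_
    by_cases htr : t ∈ closedBall (0 : R2n n) r
    · rw [hθr t htr, one_smul, sub_self, norm_zero]; positivity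
    · have h1 : f₁ t - θ t • f₁ t = (1 - θ t) • f₁ t := by rw [sub_smul, one_smul]
      rw [h1, norm_smul, Real.norm_of_nonneg (by linarith [hθ1 t])]
      refine (mul_le_of_le_one_left (norm_nonneg _) (by linarith [hθ0 t])).trans ?_
      rw [hf₁, norm_mul]
      exact mul_le_mul (hX t ht fun h => htr (ball_subset_closedBall h))
        (norm_alternating_le _ (hR t ht)) (norm_nonneg _) hX0
  -- the beginning of the homotopy
  set Z : R2n n → R2n n := fun t => offsetL n (g t - c) with hZ
  set f₀ : R2n n → ℂ := fun t => F (γ t) *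
    ((affineMatrix n).det * ((((offsetL n).comp (fderiv ℝ g t)).det : ℝ) : ℂ)) with hf₀
  have hjac₀ : ∀ t, jacForm n (fun k => minusPart n (fderiv ℝ g t (dir k))) =
      (affineMatrix n).det * ((((offsetL n).comp (fderiv ℝ g t)).det : ℝ) : ℂ) := by
    intro t
    rw [jacForm_minusPart, det_eq_det_offsetMatrix]
  have hf₀eq : ∀ t, θ t • (F (γ t + (0 : ℝ) • η t) * jacForm n (homCol γ η 0 t)) =
      θ t • f₀ t := by
    intro t
    by_cases ht : t ∈ tsupport θ
    · have : homCol γ η 0 t = fun k => minusPart n (fderiv ℝ g t (dir k)) := by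
        funext k
        rw [hcol t (hWO (hSW ht)), zero_smul, add_zero]
      rw [zero_smul, add_zero, this, hjac₀]
    · simp [hzero t ht]
  have hγT : ∀ t ∈ W, γ t ∈ T := fun t ht => by
    have := hmem 0 (by norm_num) t ht
    rwa [zero_smul, add_zero] at this
  have hf₀W : ContinuousOn f₀ W := by
    have h1 : ContinuousOn (fun t => F (γ t)) W := hF.continuousOn.comp cγ.continuousOn hγT
    have h2 : ContinuousOn (fderiv ℝ g) W :=
      (hg.continuousOn_fderiv_of_isOpen hO (by simp)).mono hWO
    have h3 : ContinuousOn (fun t => ((offsetL n).comp (fderiv ℝ g t)).det) W :=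
      ContinuousLinearMap.continuous_det.comp_continuousOn (continuousOn_const.clm_comp h2)
    exact h1.mul (continuousOn_const.mul (Complex.continuous_ofReal.comp_continuousOn h3))
  have hZd : ∀ t ∈ W, HasFDerivAt Z ((offsetL n).comp (fderiv ℝ g t)) t := fun t ht =>
    (offsetL n).hasFDerivAt.comp t ((hgd t (hWO ht)).sub_const c)
  have hZc : ContinuousOn Z W := fun t ht => (hZd t ht).continuousAt.continuousWithinAt
  -- By injectivity on `W` and surjectivity from the ball of radius `r`, this set lies where `θ =
  -- 1`, and `Z` maps it bijectively onto the disc.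
  set S : Set (R2n n) := W ∩ Z ⁻¹' ball 0 δ with hS
  have hSm : MeasurableSet S := (hZc.isOpen_inter_preimage hWo isOpen_ball).measurableSet
  have hrW : closedBall (0 : R2n n) r ⊆ W := closedBall_subset_ball (by linarith)
  have hSr : S ⊆ closedBall 0 r := by
    rintro t ⟨htW, htδ⟩
    obtain ⟨t', ht', he⟩ := hsurj htδ
    rwa [← hinj (hrW ht') htW he]
  have himage : Z '' S = ball 0 δ := by
    apply Subset.antisymm
    · rintro _ ⟨t, ht, rfl⟩; exact ht.2
    · intro u hu
      obtain ⟨t', ht', rfl⟩ := hsurj hu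
      exact ⟨t', ⟨hrW ht', hu⟩, rfl⟩
  -- Orientation enters here: the change of variables produces the absolute value of the real
  -- determinant, while the form carries the signed one.
  have hchange : (affineMatrix n).det * ∫ u in ball (0 : R2n n) δ, F (c + affineContour n u) =
      ∫ t in S, f₀ t := by
    rw [← himage, integral_image_eq_integral_abs_det_fderiv_smul volume hSm
      (fun t ht => (hZd t ht.1).hasFDerivWithinAt) (hinj.mono inter_subset_left),
      ← integral_const_mul]
    refine setIntegral_congr_fun hSm fun t ht => ?_
    simp only [hf₀, hZ, hγ]
    rw [affineContour_offsetL, abs_of_pos (hdet t ht.1), Complex.real_smul]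
    ring
  have iθf₀ : Integrable fun t => θ t • f₀ t :=
    integrable_smul_of_tsupport_subset hWo hθ.continuous hcs hSW hf₀W
  have hvolW : volume.real W ≤ volume.real Q :=
    measureReal_mono hWQ hQ.measure_lt_top.ne
  have step₀ : ‖(∫ t, θ t • f₀ t) - ∫ t in S, f₀ t‖ ≤ X * J * volume.real Q := by
    have e1 : ∫ t in S, f₀ t = ∫ t in S, θ t • f₀ t :=
      setIntegral_congr_fun hSm fun t ht => by simp only [hθr t (hSr ht), one_smul]
    rw [e1, ← setIntegral_eq_integral_of_forall_compl_eq_zero (s := W) (f := fun t => θ t • f₀ t)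
      (fun t ht => by rw [hzero t fun h => ht (hSW h), zero_smul]),
      ← setIntegral_sdiff hSm iθf₀.integrableOn inter_subset_left]
    have hfin : volume (W \ S) < ⊤ :=
      (measure_mono (sdiff_subset.trans hWQ)).trans_lt hQ.measure_lt_top
    have hle : volume.real (W \ S) ≤ volume.real Q :=
      measureReal_mono (sdiff_subset.trans hWQ) hQ.measure_lt_top.ne
    refine (norm_setIntegral_le_of_norm_le_const (C := X * J) hfin fun t ht => ?_).trans (by gcongr)
    rw [norm_smul, Real.norm_of_nonneg (hθ0 t)]
    refine (mul_le_of_le_one_left (norm_nonneg _) (hθ1 t)).trans ?_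
    -- Outside `S` the offset is at least `δ`, so `F` at the affine point is bounded by `X`.
    have hδ : δ ≤ ‖Z t‖ := by
      by_contra h
      exact ht.2 ⟨ht.1, by simpa using not_le.1 h⟩
    rw [hf₀, norm_mul, ← hjac₀]
    refine mul_le_mul (hXδ t ht.1 hδ) (norm_alternating_le _ fun k => ?_) (norm_nonneg _) hX0
    exact (norm_minusPart_le _).trans (hR t (hWQ ht.1) k)
  simp only [hf₁eq, hf₀eq] at hstokes
  have hvolS : volume.real (tsupport θ) ≤ volume.real Q :=
    measureReal_mono (hSW.trans hWQ) hQ.measure_lt_top.ne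
  have hΘX : 0 ≤ Fintype.card (Fin n ⊕ Fin n) * (Θ * X) := by
    rw [← mul_assoc]; positivity
  have hstokes' := hstokes.trans (mul_le_mul_of_nonneg_left hvolS (by positivity))
  rw [hchange]
  have tri : (∫ t in Q, f₁ t) - ∫ t in S, f₀ t =
      ((∫ t in Q, f₁ t) - ∫ t, θ t • f₁ t) + ((∫ t, θ t • f₁ t) - ∫ t, θ t • f₀ t) +
        ((∫ t, θ t • f₀ t) - ∫ t in S, f₀ t) := by ring
  rw [tri]
  refine (norm_add₃_le).trans ?_
  linarith

end ContourIntegral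

/-! ### Comparison of a good contour with the affine disc. -/

section Comparison

open MeasureTheory Set Metric Filter Topology

variable {n : ℕ}

/-- The operator over the piece of size `δ` of the affine contour. -/
def affineOp (Ψ a : Cn n × Cn n → ℂ) (δ : ℝ) (y : Cn n) (h : ℝ) : ℂ :=
  (1 / (2 * Complex.I * (h : ℂ)) ^ n) * ((affineMatrix n).det *
    ∫ u in ball (0 : R2n n) δ, integrand Ψ a y h ((y, conjVec y) + affineContour n u))

theorem mem_phaseDomain_tube {U : Set (Cn n)} {ρ ε : ℝ} {y : Cn n} (hy : ball y ε ⊆ U)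
    (hε : ε ≤ ρ) {p : Cn n × Cn n} (hp : ‖p - (y, conjVec y)‖ < ε) :
    p ∈ phaseDomain (tube U ρ) y := by
  have hε0 : 0 < ε := (norm_nonneg _).trans_lt hp
  refine ⟨mem_tube_of_norm_lt hy hε hp, mem_tube_of_norm_lt hy hε ?_,
    mem_tube_of_norm_lt hy hε ?_⟩
  · rw [Prod.mk_sub_mk, sub_self, Prod.norm_mk, norm_zero]
    exact max_lt ((norm_fst_le (p - (y, conjVec y))).trans_lt hp) hε0
  · rw [Prod.mk_sub_mk, sub_self, Prod.norm_mk, norm_zero]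
    exact max_lt hε0 ((norm_snd_le (p - (y, conjVec y))).trans_lt hp)

theorem exp_phase_le {K d h x : ℝ} (hh : 0 < h) (hx : x ≤ -((2 * K)⁻¹ * d ^ 2)) :
    Real.exp (2 / h * x) ≤ Real.exp (-(K⁻¹ * d ^ 2 / h)) := by
  rw [Real.exp_le_exp]
  have : 2 / h * x ≤ 2 / h * -((2 * K)⁻¹ * d ^ 2) := by gcongr
  refine this.trans_eq ?_
  rw [mul_inv]
  ring

/-- The radius `δ₀` depends on the contour, but every smaller `δ` is allowed, so two contours can
share one disc. The rate involves only `s`, `K` and `C`; the contour affects `M` alone. -/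
theorem IsGoodContour.exists_norm_contourOp_sub_affineOp_le {s ρ K C A h₀ : ℝ} (hs : 1 < s)
    (hρ : 0 < ρ) (hK : 0 < K) (hC : 0 < C) (hA : 0 ≤ A) {Φ : Cn n → ℝ} {U : Set (Cn n)}
    (hU : IsOpen U)
    {Ψ : Cn n × Cn n → ℂ} (hΨ : IsPolarization s Φ U ρ Ψ)
    (hlevi : ∀ y ∈ U, ∀ ξ, 0 ≤ (leviForm Φ y ξ).re) (hf : DbarFlat s C Ψ (tube U ρ))
    {a : ℝ → Cn n × Cn n → ℂ} (ha : ∀ h, 0 < h → h ≤ h₀ → ContDiffOn ℝ ∞ (a h) (tube U ρ))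
    (haf : ∀ h, 0 < h → h ≤ h₀ → DbarFlat s C (a h) (tube U ρ))
    (haA : ∀ h, 0 < h → h ≤ h₀ → ∀ p ∈ tube U ρ, ‖a h p‖ ≤ A)
    {L : Set (Cn n)} (hL : IsCompact L) (hLU : L ⊆ U) {Γ : Contour n}
    (hΓ : IsGoodContour (tube U ρ) Ψ K L Γ) {y₀ : Cn n} (hy₀ : y₀ ∈ L) :
    ∃ δ₀ > 0, ∀ δ, 0 < δ → δ ≤ δ₀ → ∃ M, ∀ᶠ y in 𝓝 y₀, y ∈ L → ∀ h, 0 < h → h ≤ h₀ →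
      ‖contourOp Ψ Γ a y h - affineOp Ψ (a h) δ y h‖ ≤
        M * Real.exp (-(rate s K C / 2 * h ^ (-(1 / (2 * s - 1))))) := by
  have hT := isOpen_tube hU ρ
  obtain ⟨O, hO, hLO, hsm⟩ := hΓ.smooth
  set m : Cn n × R2n n → Cn n × Cn n := fun p => Γ.map p.1 p.2 with hm
  have hmem0 : (0 : R2n n) ∈ Γ.dom := mem_of_mem_nhds hΓ.dom_nhds
  have hy₀O : (y₀, (0 : R2n n)) ∈ O := hLO ⟨hy₀, hmem0⟩
  -- regularity of the slices
  have hslO : ∀ y, IsOpen {t : R2n n | (y, t) ∈ O} := fun y =>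
    hO.preimage (by fun_prop : Continuous fun t : R2n n => (y, t))
  have hsl : ∀ y, ContDiffOn ℝ ∞ (Γ.map y) {t | (y, t) ∈ O} := fun y =>
    hsm.comp (by fun_prop : ContDiff ℝ ∞ fun t : R2n n => (y, t)).contDiffOn fun t ht => ht
  have hfd : ∀ p ∈ O, fderiv ℝ (Γ.map p.1) p.2 =
      (fderiv ℝ m p).comp (ContinuousLinearMap.inr ℝ (Cn n) (R2n n)) := by
    rintro ⟨y, t⟩ hp
    have h1 : HasFDerivAt m (fderiv ℝ m (y, t)) (y, t) :=
      ((hsm.contDiffAt (hO.mem_nhds hp)).differentiableAt (by simp)).hasFDerivAt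
    exact (h1.comp t (hasFDerivAt_prodMk_right y t)).fderiv
  have hfdc : ContinuousOn (fun p : Cn n × R2n n => fderiv ℝ (Γ.map p.1) p.2) O :=
    ((hsm.continuousOn_fderiv_of_isOpen hO (by simp)).clm_comp continuousOn_const).congr hfd
  set e : Cn n × R2n n → Cn n × Cn n := fun p => Γ.map p.1 p.2 - (p.1, conjVec p.1) with he
  have hec : ContinuousOn e O :=
    hsm.continuousOn.sub (((antidiag n).continuous.comp continuous_fst).continuousOn)
  have he0 : ∀ y ∈ L, e (y, 0) = 0 := fun y hy => by simp [he, hΓ.center y hy]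
  -- the phase near the critical point
  obtain ⟨ε, hε, hερ, hph⟩ := exists_phase_contract_le hs hρ hK hU hΨ hlevi (hLU hy₀)
  -- For `|σ| ≤ 2` the homotopy moves at most `3‖e‖` from the centre, and `ε/4` keeps this below
  -- `ε`.
  have hnear : ∀ᶠ p in 𝓝 (y₀, (0 : R2n n)), ‖e p‖ < ε / 4 ∧ p.2 ∈ Γ.dom := by
    refine Filter.Eventually.and ?_ ?_
    · exact (hec.continuousAt (hO.mem_nhds hy₀O)).norm.eventually_lt continuousAt_const
        (by rw [he0 y₀ hy₀, norm_zero]; positivity)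
    · exact (continuous_snd.tendsto (y₀, (0 : R2n n))).eventually_mem hΓ.dom_nhds
  -- the inverse function theorem
  obtain ⟨r₀, hr₀, μ, hμ, hinv⟩ := exists_uniform_inverse (y₀ := y₀)
    (Z := fun y t => offsetL n (Γ.map y t - (y, conjVec y)))
    (Z' := fun y t => (offsetL n).comp (fderiv ℝ (Γ.map y) t)) (by
      filter_upwards [hO.mem_nhds hy₀O] with p hp
      have h1 : HasFDerivAt (Γ.map p.1) (fderiv ℝ (Γ.map p.1) p.2) p.2 :=
        (((hsl p.1).contDiffAt ((hslO p.1).mem_nhds hp)).differentiableAt (by simp)).hasFDerivAt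
      exact (offsetL n).hasFDerivAt.comp p.2 (h1.sub_const _))
    ((continuousOn_const.clm_comp hfdc).continuousAt (hO.mem_nhds hy₀O)) (by
      have := hΓ.oriented y₀ hy₀
      rw [orientMatrix_eq] at this
      rw [det_eq_det_offsetMatrix]
      exact this)
  rw [nhds_prod_eq] at hnear
  obtain ⟨P, hP, P', hP', hPP⟩ := eventually_prod_iff.1 hnear
  obtain ⟨r₁, hr₁, hball⟩ := Metric.eventually_nhds_iff_ball.1 hP'
  set r : ℝ := min r₀ r₁ / 2 with hr
  have hmin : 0 < min r₀ r₁ := lt_min hr₀ hr₁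
  have hrpos : 0 < r := by positivity
  have h2r : 2 * r = min r₀ r₁ := by rw [hr]; ring
  have hb0 : ball (0 : R2n n) (2 * r) ⊆ ball 0 r₀ :=
    ball_subset_ball (h2r.trans_le (min_le_left _ _))
  have hb1 : ball (0 : R2n n) (2 * r) ⊆ ball 0 r₁ :=
    ball_subset_ball (h2r.trans_le (min_le_right _ _))
  have hrr₀ : r < r₀ := by
    have := min_le_left r₀ r₁
    linarith
  -- the cut-off
  let θ : ContDiffBump (0 : R2n n) := ⟨r, 3 / 2 * r, hrpos, by linarith⟩
  have hθ : ContDiff ℝ 1 θ := θ.contDiff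
  obtain ⟨Θ, hΘ⟩ := (hθ.continuous_fderiv (by norm_num)).bounded_above_of_compact_support
    (θ.hasCompactSupport.fderiv ℝ)
  have hΘ' : ∀ t k, ‖fderiv ℝ θ t (dir k)‖ ≤ Θ := fun t k =>
    ((fderiv ℝ θ t).le_opNorm _).trans (by simpa using hΘ t)
  -- bounds on the contour
  obtain ⟨R₁, hR₁⟩ := (hL.prod hΓ.compact_dom).exists_bound_of_continuousOn (hfdc.mono hLO)
  -- By injectivity the contour meets its centre only at `t = 0`; compactness makes the separation
  -- uniform in `y`.
  obtain ⟨d₁, hd₁, hfar⟩ : ∃ d₁ > 0, ∀ p ∈ L ×ˢ (Γ.dom \ ball (0 : R2n n) r), d₁ ≤ ‖e p‖ := by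
    refine (hL.prod (hΓ.compact_dom.diff isOpen_ball)).exists_forall_le'
      (hec.mono ((prod_mono_right sdiff_subset).trans hLO)).norm fun p hp => ?_
    rw [norm_pos_iff, he, sub_ne_zero, ← hΓ.center p.1 hp.1]
    intro h
    have := hΓ.injective p.1 hp.1 hp.2.1 hmem0 h
    exact hp.2.2 (by rw [this]; exact mem_ball_self hrpos)
  refine ⟨μ * r, by positivity, fun δ hδ hδ₀ => ?_⟩
  -- An offset of size `δ` forces a distance of at least `δ/2`, since the offset map has norm at
  -- most `2`. At distance `d` or more, the integrand is `O(exp(-K⁻¹d²/h))`.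
  set d : ℝ := min d₁ (δ / 2) with hd
  have hdpos : 0 < d := lt_min hd₁ (by positivity)
  have hβ0 : 0 < 1 / (2 * s - 1) := one_div_pos.2 (by linarith)
  have hβ1 : 1 / (2 * s - 1) < 1 := by rw [div_lt_one (by linarith)]; linarith
  have hrate := rate_pos (s := s) hK hC
  obtain ⟨M₁, hM₁, hexp⟩ := exists_exp_neg_div_le (c := rate s K C) (c' := K⁻¹ * d ^ 2) hβ0 hβ1
    hrate (by positivity)
  -- The power `h⁻ⁿ` is the prefactor of the operator; one more `h⁻¹` comes from differentiating
  -- `2φ/h`.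
  obtain ⟨M₂, hM₂, habs⟩ := exists_inv_pow_mul_exp_le (c := rate s K C / 2) hβ0 (by positivity) n
  obtain ⟨M₃, hM₃, habs'⟩ := exists_inv_pow_mul_exp_le (c := rate s K C / 2) hβ0 (by positivity)
    (n + 1)
  set R : ℝ := max R₁ ε with hR
  have hR0 : 0 ≤ R := hε.le.trans (le_max_right _ _)
  set N : ℝ := ((Fintype.card (Fin n ⊕ Fin n) : ℕ) : ℝ) with hN
  set J : ℝ := ‖jacForm n‖ * R ^ Fintype.card (Fin n ⊕ Fin n) * volume.real Γ.dom with hJ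
  have hJ0 : 0 ≤ J := by positivity
  have hN0 : 0 ≤ N := by positivity
  have hΘ0 : 0 ≤ Θ := (norm_nonneg _).trans (hΘ 0)
  refine ⟨(2 * (A * M₁) + (N + 1) * (2 * n * C * R) + N * (Θ * (A * M₁))) * J * M₂ +
    (N + 1) * (12 * n * A * C * R) * J * M₃, ?_⟩
  filter_upwards [hph, hinv, hP] with y ⟨hyU, hyph⟩ ⟨hyinj, hyder, hysurj⟩ hyP hyL h hh hhh₀
  set Ex : ℝ := Real.exp (-(rate s K C * h ^ (-(1 / (2 * s - 1))))) with hEx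
  have hEx0 : 0 ≤ Ex := (Real.exp_pos _).le
  have hW : ∀ t ∈ ball (0 : R2n n) (2 * r), ‖e (y, t)‖ < ε / 4 ∧ t ∈ Γ.dom := fun t ht =>
    hPP hyP (hball t (hb1 ht))
  have hgood : ∀ t ∈ Γ.dom, (phase Ψ (y, conjVec y) (Γ.map y t)).re ≤
      -(K⁻¹ * (‖(e (y, t)).1‖ ^ 2 + ‖(e (y, t)).2‖ ^ 2)) := fun t ht => hΓ.good y hyL t ht
  have hσphase : ∀ σ ∈ Icc (0 : ℝ) 1, ∀ t ∈ ball (0 : R2n n) (2 * r),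
      (phase Ψ (y, conjVec y) ((y, conjVec y) + minusPart n (Γ.map y t - (y, conjVec y)) +
        σ • plusPart n (Γ.map y t - (y, conjVec y)))).re ≤ -((2 * K)⁻¹ * ‖e (y, t)‖ ^ 2) := by
    intro σ hσ t ht
    have := hyph ((1 / 2 : ℝ) • ((e (y, t)).1 - conjVec (e (y, t)).2))
      ((1 / 2 : ℝ) • ((e (y, t)).1 + conjVec (e (y, t)).2))
    rw [contract_one_eq] at this
    have h2 := this (by linarith [(hW t ht).1]) (by
      have h3 := hgood t (hW t ht).2
      simpa [he] using h3) σ hσ.1 hσ.2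
    rwa [← minusPart_add_smul_plusPart, ← add_assoc] at h2
  have hdom : ∀ σ ∈ Ioo (-1 : ℝ) 2, ∀ t ∈ ball (0 : R2n n) (2 * r),
      (y, conjVec y) + minusPart n (Γ.map y t - (y, conjVec y)) +
        σ • plusPart n (Γ.map y t - (y, conjVec y)) ∈ phaseDomain (tube U ρ) y := by
    intro σ hσ t ht
    refine mem_phaseDomain_tube hyU hερ ?_
    rw [add_assoc, add_sub_cancel_left]
    refine (norm_add_le _ _).trans_lt ?_
    rw [norm_smul]
    have h1 := norm_minusPart_le (e (y, t))
    have h2 := norm_plusPart_le (e (y, t))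
    have h3 : ‖σ‖ ≤ 2 := by rw [Real.norm_eq_abs, abs_le]; constructor <;> linarith [hσ.1, hσ.2]
    have h4 := (hW t ht).1
    have h5 : ‖σ‖ * ‖plusPart n (e (y, t))‖ ≤ 2 * ‖e (y, t)‖ :=
      mul_le_mul h3 h2 (norm_nonneg _) (by norm_num)
    calc _ ≤ ‖e (y, t)‖ + 2 * ‖e (y, t)‖ := add_le_add h1 h5
      _ < ε := by linarith
  have hIccIoo : ∀ σ ∈ Icc (0 : ℝ) 1, σ ∈ Ioo (-1 : ℝ) 2 := fun σ hσ =>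
    ⟨by linarith [hσ.1], by linarith [hσ.2]⟩
  have hsmall : ∀ p ∈ tube U ρ,
      (phase Ψ (y, conjVec y) p).re ≤ -((2 * K)⁻¹ * d ^ 2) →
      ‖integrand Ψ (a h) y h p‖ ≤ A * (M₁ * Ex) := by
    intro p hp hpd
    rw [norm_integrand, mul_comm]
    exact mul_le_mul (haA h hh hhh₀ p hp) ((exp_phase_le hh hpd).trans (hexp h hh))
      (Real.exp_pos _).le hA
  have hKd : ∀ x, d ≤ x → -((2 * K)⁻¹ * x ^ 2) ≤ -((2 * K)⁻¹ * d ^ 2) := by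
    intro x hx
    rw [neg_le_neg_iff]
    gcongr
  -- `X` bounds the integrand away from the critical point. `Y` bounds its antilinear derivative
  -- along the homotopy, by the balance of Gaussian and flat weight.
  have key := norm_contour_integral_sub_le (g := Γ.map y) (c := (y, conjVec y))
    (F := integrand Ψ (a h) y h) (T := phaseDomain (tube U ρ) y) (θ := θ) (R := R) (Θ := Θ)
    (X := A * (M₁ * Ex)) (Y := (12 * n * A * h⁻¹ + 2 * n) * (C * Ex)) (δ := δ)
    hΓ.compact_dom (hslO y) (fun t ht => hLO ⟨hyL, ht⟩) (hsl y) (isOpen_phaseDomain hT y)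
    ((contDiffOn_integrand hΨ.gevrey.1 (ha h hh hhh₀) y h).of_le (by norm_cast))
    (fun t ht => ⟨(hΓ.mem_domain y hyL t ht).1, (hΓ.mem_domain y hyL t ht).2.1,
      (hΓ.mem_domain y hyL t ht).2.2.1⟩) hrpos (fun t ht => (hW t ht).2) hdom hθ
    (by rw [θ.tsupport_eq]) (fun t => θ.nonneg) (fun t => θ.le_one)
    (fun t ht => θ.one_of_mem_closedBall ht) hΘ'
    (fun t ht k => ((fderiv ℝ (Γ.map y) t).le_opNorm _).trans (by
      have h1 : ‖fderiv ℝ (Γ.map y) t‖ ≤ R := (hR₁ (y, t) ⟨hyL, ht⟩).trans (le_max_left _ _)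
      simpa using h1))
    (fun t ht => ((hW t ht).1.le.trans (by linarith)).trans (le_max_right _ _))
    (by positivity) (by positivity)
    (fun t ht htr => hsmall _ (hΓ.mem_domain y hyL t ht).1 (by
      have h1 : d ≤ ‖e (y, t)‖ := (min_le_left _ _).trans (hfar (y, t) ⟨hyL, ht, htr⟩)
      have h2 := sq_norm_le_add_sq (e (y, t))
      have h3 : (2 * K)⁻¹ ≤ K⁻¹ := by gcongr; linarith
      refine (hgood t ht).trans (le_trans ?_ (hKd _ h1))
      rw [neg_le_neg_iff]
      exact mul_le_mul h3 h2 (by positivity) (by positivity)))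
    (fun σ hσ t ht htr => hsmall _ (hdom σ (hIccIoo σ hσ) t ht).1
      ((hσphase σ hσ t ht).trans (hKd _ ((min_le_left _ _).trans
        (hfar (y, t) ⟨hyL, (hW t ht).2, htr⟩)))))
    (fun t ht htδ => by
      have h1 := hσphase 0 ⟨le_rfl, zero_le_one⟩ t ht
      have h2 := (hdom 0 (by norm_num) t ht).1
      rw [zero_smul, add_zero] at h1 h2
      refine hsmall _ h2 (h1.trans (hKd _ ((min_le_right _ _).trans ?_)))
      have := htδ.trans (norm_offsetL_le _)
      simp only [he]
      linarith)
    (fun σ hσ t ht ζ => by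
      refine (norm_antiPart_integrand_le hs hC hT hΨ.gevrey.1 hf (ha h hh hhh₀) (haf h hh hhh₀)
        (haA h hh hhh₀) (hdom σ (hIccIoo σ hσ) t ht) hh ζ).trans ?_
      refine mul_le_mul_of_nonneg_right ?_ (norm_nonneg ζ)
      rw [mul_left_comm]
      refine mul_le_mul_of_nonneg_left ?_ (by positivity)
      refine gauss_mul_flatWeight_le hs hK hC (norm_nonneg _) hh ?_
      refine (hσphase σ hσ t ht).trans ?_
      rw [neg_le_neg_iff, add_assoc, add_sub_cancel_left]
      gcongr
      exact norm_minusPart_add_smul_plusPart_le _ hσ.1 hσ.2)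
    (hyinj.mono hb0) (fun t ht => (hyder t (hb0 ht)).2)
    (by
      have h1 := hysurj r hrpos hrr₀
      have h2 : offsetL n (Γ.map y 0 - (y, conjVec y)) = 0 := by
        rw [hΓ.center y hyL, sub_self, map_zero]
      simp only [h2] at h1
      exact (ball_subset_closedBall.trans (closedBall_subset_closedBall hδ₀)).trans h1)
  have hop : contourOp Ψ Γ a y h = (1 / (2 * Complex.I * (h : ℂ)) ^ n) *
      ∫ t in Γ.dom, integrand Ψ (a h) y h (Γ.map y t) *
        jacForm n (fun k => fderiv ℝ (Γ.map y) t (dir k)) := by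
    simp only [contourOp, jac_eq_jacForm]
    rfl
  rw [hop, affineOp, ← mul_sub, norm_mul]
  have hpre : ‖1 / (2 * Complex.I * (h : ℂ)) ^ n‖ ≤ h⁻¹ ^ n := by
    rw [norm_div, norm_one, norm_pow, one_div, ← inv_pow]
    gcongr
    simp only [norm_mul, Complex.norm_I, Complex.norm_real, Real.norm_of_nonneg hh.le]
    norm_num
    linarith
  have hcalc : (2 * (A * (M₁ * Ex)) + (N + 1) * ((12 * n * A * h⁻¹ + 2 * n) * (C * Ex) * R) +
      N * (Θ * (A * (M₁ * Ex)))) * (‖jacForm n‖ * R ^ Fintype.card (Fin n ⊕ Fin n)) *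
      volume.real Γ.dom =
      (2 * (A * M₁) + (N + 1) * (2 * n * C * R) + N * (Θ * (A * M₁))) * J * Ex +
      (N + 1) * (12 * n * A * C * R) * J * (h⁻¹ * Ex) := by
    rw [hJ]; ring
  rw [hcalc] at key
  have a1 := habs h hh
  have a2 := habs' h hh
  have hrr : 2 * (rate s K C / 2) = rate s K C := by ring
  rw [hrr, ← hEx] at a1 a2
  set Eh : ℝ := Real.exp (-(rate s K C / 2 * h ^ (-(1 / (2 * s - 1)))))
  calc _ ≤ h⁻¹ ^ n * ((2 * (A * M₁) + (N + 1) * (2 * n * C * R) + N * (Θ * (A * M₁))) * J * Ex +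
      (N + 1) * (12 * n * A * C * R) * J * (h⁻¹ * Ex)) :=
        mul_le_mul hpre key (norm_nonneg _) (by positivity)
    _ = (2 * (A * M₁) + (N + 1) * (2 * n * C * R) + N * (Θ * (A * M₁))) * J * (h⁻¹ ^ n * Ex) +
      (N + 1) * (12 * n * A * C * R) * J * (h⁻¹ ^ (n + 1) * Ex) := by ring
    _ ≤ (2 * (A * M₁) + (N + 1) * (2 * n * C * R) + N * (Θ * (A * M₁))) * J * (M₂ * Eh) +
      (N + 1) * (12 * n * A * C * R) * J * (M₃ * Eh) := by gcongr
    _ = _ := by ring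

end Comparison

end GevreyBergman

end

/-! ### The theorem: two contours, one affine disc, and compactness. -/

open GevreyBergman in
theorem mainTheorem9 (n : ℕ) (s : ℝ) (hs : 1 < s)
    (Ω : Set (GevreyBergman.Cn n)) (hΩ : IsOpen Ω)
    (Φ : GevreyBergman.Cn n → ℝ)
    (hΦ : GevreyBergman.IsGevrey (GevreyBergman.reIm n) s Φ Ω)
    (hpsh : GevreyBergman.StrictlyPSH Φ Ω)
    (x₀ : GevreyBergman.Cn n)
    (U : Set (GevreyBergman.Cn n)) (hU : IsOpen U) (hx₀ : x₀ ∈ U)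
    (hUc : IsCompact (closure U)) (hUΩ : closure U ⊆ Ω)
    (ρ : ℝ) (hρ : 0 < ρ)
    (Ψ : GevreyBergman.Cn n × GevreyBergman.Cn n → ℂ)
    (hΨ : GevreyBergman.IsPolarization s Φ U ρ Ψ) :
    ∃ V₀ : Set (GevreyBergman.Cn n), IsOpen V₀ ∧ x₀ ∈ V₀ ∧
      IsCompact (closure V₀) ∧ closure V₀ ⊆ U ∧
      ∀ (h₀ : ℝ), 0 < h₀ →
      ∀ a : ℝ → GevreyBergman.Cn n × GevreyBergman.Cn n → ℂ,
        GevreyBergman.IsGevreyAmplitude s h₀ (GevreyBergman.tube U ρ) a →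
      ∀ K : ℝ, 0 < K → ∃ C : ℝ, 0 < C ∧
        ∀ V : Set (GevreyBergman.Cn n), V ⊆ V₀ →
        ∀ Γ₀ Γ₁ : GevreyBergman.Contour n,
          GevreyBergman.IsGoodContour (GevreyBergman.tube U ρ) Ψ K (closure V) Γ₀ →
          GevreyBergman.IsGoodContour (GevreyBergman.tube U ρ) Ψ K (closure V) Γ₁ →
          ∃ M : ℝ, ∀ y ∈ V, ∀ h : ℝ, 0 < h → h ≤ h₀ →
            ‖GevreyBergman.contourOp Ψ Γ₀ a y h - GevreyBergman.contourOp Ψ Γ₁ a y h‖ ≤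
              M * Real.exp (-(C⁻¹ * h ^ (-(1 / (2 * s - 1))))) := by
  obtain ⟨V₀, hV₀o, hxV₀, hV₀U, hV₀c⟩ := exists_open_between_and_isCompact_closure
    (isCompact_singleton (x := x₀)) hU (Set.singleton_subset_iff.2 hx₀)
  refine ⟨V₀, hV₀o, Set.singleton_subset_iff.1 hxV₀, hV₀c, hV₀U, fun h₀ _ a ha K hK => ?_⟩
  obtain ⟨C₁, hC₁, hf₁⟩ := hΨ.flat
  obtain ⟨C₂, hC₂, hf₂⟩ := ha.flat
  obtain ⟨aj, -, A, hA, hexp⟩ := ha.expansion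
  have hmono : ∀ {C C' : ℝ} {f : Cn n × Cn n → ℂ}, 0 < C → C ≤ C' →
      DbarFlat s C f (tube U ρ) → DbarFlat s C' f (tube U ρ) := fun h0 hle hf p hp j =>
    ⟨(hf p hp j).1.trans (flatWeight_le_of_le h0 hle (norm_nonneg _)),
      (hf p hp j).2.trans (flatWeight_le_of_le h0 hle (norm_nonneg _))⟩
  -- The case `N = 0`, `α = 0` of the expansion is a sup bound uniform in `h`.
  have haA : ∀ h, 0 < h → h ≤ h₀ → ∀ p ∈ tube U ρ, ‖a h p‖ ≤ A := by
    intro h hh hhh p hp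
    have := hexp h hh hhh 0 p hp 0 (fun i => i.elim0)
    simpa using this
  have hlevi : ∀ y ∈ U, ∀ ξ, 0 ≤ (leviForm Φ y ξ).re := by
    obtain ⟨c, -, hc, hle⟩ := hpsh
    intro y hy ξ
    have hyΩ := hUΩ (subset_closure hy)
    have := hc y hyΩ
    exact le_trans (by positivity) (hle y hyΩ ξ)
  set C : ℝ := max C₁ C₂
  have hC : 0 < C := lt_max_of_lt_left hC₁
  have hrate := rate_pos (s := s) hK hC
  -- The constant is fixed before `V` and the contours appear; it uses only `s`, `K` and the
  -- flatness constants of `Ψ` and `a`.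
  refine ⟨(rate s K C / 2)⁻¹, by positivity, fun V hV Γ₀ Γ₁ hΓ₀ hΓ₁ => ?_⟩
  rw [inv_inv]
  have hL : IsCompact (closure V) := hV₀c.of_isClosed_subset isClosed_closure (closure_mono hV)
  have hLU : closure V ⊆ U := (closure_mono hV).trans hV₀U
  have hlocal : ∀ y₀ ∈ closure V, ∃ M, ∀ᶠ y in nhds y₀, y ∈ closure V → ∀ h, 0 < h → h ≤ h₀ →
      ‖contourOp Ψ Γ₀ a y h - contourOp Ψ Γ₁ a y h‖ ≤
        M * Real.exp (-(rate s K C / 2 * h ^ (-(1 / (2 * s - 1))))) := by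
    intro y₀ hy₀
    have main := fun {Γ : Contour n} (hΓ : IsGoodContour (tube U ρ) Ψ K (closure V) Γ) =>
      hΓ.exists_norm_contourOp_sub_affineOp_le hs hρ hK hC hA.le hU hΨ hlevi
        (hmono hC₁ (le_max_left _ _) hf₁) ha.smooth
        (fun h hh hhh => hmono hC₂ (le_max_right _ _) (hf₂ h hh hhh)) haA hL hLU hy₀
    obtain ⟨δ₀, hδ₀, H₀⟩ := main hΓ₀
    obtain ⟨δ₁, hδ₁, H₁⟩ := main hΓ₁
    -- The common radius makes the affine terms identical, so they cancel in the difference.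
    obtain ⟨M₀, hM₀⟩ := H₀ (min δ₀ δ₁) (lt_min hδ₀ hδ₁) (min_le_left _ _)
    obtain ⟨M₁, hM₁⟩ := H₁ (min δ₀ δ₁) (lt_min hδ₀ hδ₁) (min_le_right _ _)
    refine ⟨M₀ + M₁, ?_⟩
    filter_upwards [hM₀, hM₁] with y h0 h1 hy h hh hhh
    have b0 := h0 hy h hh hhh
    have b1 := h1 hy h hh hhh
    rw [norm_sub_rev] at b1
    refine (norm_sub_le_norm_sub_add_norm_sub _ (affineOp Ψ (a h) (min δ₀ δ₁) y h) _).trans ?_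
    linarith
  have hglobal : ∃ M : ℝ, ∀ y ∈ closure V, ∀ h, 0 < h → h ≤ h₀ →
      ‖contourOp Ψ Γ₀ a y h - contourOp Ψ Γ₁ a y h‖ ≤
        M * Real.exp (-(rate s K C / 2 * h ^ (-(1 / (2 * s - 1))))) := by
    -- The rate is the same near every `y₀`, so a finite cover only requires the maximum of the
    -- constants `M`.
    refine hL.induction_on (p := fun S => ∃ M : ℝ, ∀ y ∈ S, ∀ h, 0 < h → h ≤ h₀ →
      ‖contourOp Ψ Γ₀ a y h - contourOp Ψ Γ₁ a y h‖ ≤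
        M * Real.exp (-(rate s K C / 2 * h ^ (-(1 / (2 * s - 1)))))) ⟨0, by simp⟩ ?_ ?_ ?_
    · rintro S S' hSS' ⟨M, hM⟩
      exact ⟨M, fun y hy => hM y (hSS' hy)⟩
    · rintro S S' ⟨M, hM⟩ ⟨M', hM'⟩
      refine ⟨max M M', fun y hy h hh hhh => ?_⟩
      rcases hy with hy | hy
      · exact (hM y hy h hh hhh).trans (by gcongr; exact le_max_left _ _)
      · exact (hM' y hy h hh hhh).trans (by gcongr; exact le_max_right _ _)
    · intro y₀ hy₀
      obtain ⟨M, hM⟩ := hlocal y₀ hy₀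
      refine ⟨_, inter_mem_nhdsWithin _ hM, M, fun y hy => hy.2 hy.1⟩
  obtain ⟨M, hM⟩ := hglobal
  exact ⟨M, fun y hy => hM y (subset_closure hy)⟩
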